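/- Let $R>0$, $\rho_0>0$, and write points $x\in\mathbb R^2$ in elliptic coordinates, $x=(R\cos\omega_x\cosh\rho_x,\;R\sin\omega_x\sinh\rho_x)$ with $\rho_x\ge 0$. Let $\Omega=\{\rho_x<\rho_0\}$ be the ellipse of elliptic radius $\rho_0$, with outward unit normal $\nu$, let $z$ be a point with $\rho_z>\rho_0$, let $a\in\mathbb R^2$, and put $$\Gamma(x)=\frac1{2\pi}\ln|x|,\qquad F_z(x)=-a\cdot\nabla_x\Gamma(x-z)\quad(x\ne z).$$ Let $\epsilon_m>0$ and, for $\delta>0$, let $\epsilon_{\rm in}(\delta)\in\mathbb C$ be given either by $\epsilon_{\rm in}(\delta)=-\epsilon_m+i\delta$ for all $\delta>0$, or by the normalization $$\lambda:=\frac{\epsilon_{\rm in}(\delta)+\epsilon_m}{2(\epsilon_{\rm in}(\delta)-\epsilon_m)}=i\delta\quad\text{for all }\delta>0 .$$ Let $u_\delta$ be the solution of the transmission problem $\nabla\cdot\epsilon\nabla u=\epsilon_m\Delta F_z$ in $\mathbb R^2$, $u(x)=O(|x|^{-1})$ as $|x|\to\infty$, where $\epsilon=\epsilon_{\rm in}(\delta)$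 in $\Omega$ and $\epsilon=\epsilon_m$ in $\mathbb R^2\setminus\overline\Omega$. That is: $u_\delta$ is harmonic in $\Omega$; $u_\delta-F_z$ extends to a harmonic function in all of $\mathbb R^2\setminus\overline\Omega$ (including $z$); $u_\delta$ is continuous on $\mathbb R^2\setminus\{z\}$; $\nabla u_\delta$ extends continuously to $\partial\Omega$ from each side, with $\epsilon_m\,\partial_\nu u_\delta|_+=\epsilon_{\rm in}(\delta)\,\partial_\nu u_\delta|_-$ on $\partial\Omega$; and $u_\delta(x)=O(|x|^{-1})$ at infinity. Then: 1. There is a constant $C>0$, independent of $\delta$ and $x$, such that for all $\delta>0$ and all $x\neq z$ with $\rho_x+\rho_z-4\rho_0>0$, $$|u_\delta(x)-F_z(x)|\le C\sum_{n=1}^\infty e^{-n(\rho_x+\rho_z-4\rho_0)} .$$ 2. For every $\overline\rho>0$ with $\overline\rho>4\rho_0-\rho_z$ there is a constant $C=C_{\overline\rho}>0$, independent of $\delta$, such that for all $\delta>0$ $$|u_\delta(x)-F_z(x)|<C\qquad\text{for all }x\ne z\text{ with }\rho_x\ge\overline\rho .$$ -/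

import Mathlib

noncomputable section

namespace EllipseResonance

/-- The Euclidean plane `ℝ²`. -/
abbrev Plane : Type := EuclideanSpace ℝ (Fin 2)

/-- The point with elliptic coordinates `(ρ, ω)`; the foci are `(± R, 0)`. Every point of the plane
is of this form with `ρ ≥ 0`, and then `ρ` is uniquely determined by the point. -/
def ell (R ρ ω : ℝ) : Plane :=
  !₂[R * Real.cos ω * Real.cosh ρ, R * Real.sin ω * Real.sinh ρ]

/-- The (open) ellipse `Ω` of elliptic radius `ρ₀`. -/
def inside (R ρ₀ : ℝ) : Set Plane :=
  {x | ∃ ρ ω : ℝ, 0 ≤ ρ ∧ ρ < ρ₀ ∧ x = ell R ρ ω}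

/-- The exterior `ℝ² \ closure Ω`. -/
def outside (R ρ₀ : ℝ) : Set Plane :=
  {x | ∃ ρ ω : ℝ, ρ₀ < ρ ∧ x = ell R ρ ω}

/-- The outward unit normal to the ellipse at the boundary point `ell R ρ₀ ω`. -/
def unitNormal (ρ₀ ω : ℝ) : Plane :=
  (Real.sqrt (Real.sinh ρ₀ ^ 2 + Real.sin ω ^ 2))⁻¹ •
    !₂[Real.cos ω * Real.sinh ρ₀, Real.sin ω * Real.cosh ρ₀]

/-- The fundamental solution `Γ(x) = (2π)⁻¹ ln |x|` of the Laplacian in the plane. -/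
def fundSol (x : Plane) : ℝ := (2 * Real.pi)⁻¹ * Real.log ‖x‖

/-- The dipole field `F_z(x) = -a · ∇ₓ Γ(x - z)`, used for `x ≠ z` only. -/
def dipole (a z x : Plane) : ℝ := -(fderiv ℝ (fun y : Plane => fundSol (y - z)) x a)

open Filter Topology in
/-- `u` solves the transmission problem `∇ · ε ∇u = εₘ ΔF_z` in `ℝ²`, `u(x) = O(|x|⁻¹)`, where `ε` is
the complex number `εin` in the ellipse `Ω` and `εₘ` outside it. The equation is spelled out:
`u` is harmonic in `Ω`; outside `Ω` it is `F_z` plus a function that is harmonic also at `z`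
(that is, `Δu = ΔF_z` there); `u` is continuous across `∂Ω`; its gradient extends continuously to
`∂Ω` from either side, and `εₘ ∂u/∂ν|₊ = εin ∂u/∂ν|₋` on `∂Ω`. -/
structure IsSolution (R ρ₀ : ℝ) (εin : ℂ) (εm : ℝ) (a z : Plane) (u : Plane → ℂ) : Prop where
  harmonic_inside : InnerProductSpace.HarmonicOnNhd u (inside R ρ₀)
  harmonic_outside : ∃ w : Plane → ℂ, InnerProductSpace.HarmonicOnNhd w (outside R ρ₀) ∧
    ∀ x ∈ outside R ρ₀, x ≠ z → u x = (dipole a z x : ℂ) + w x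
  continuous : ContinuousOn u {z}ᶜ
  flux : ∀ ω : ℝ, ∃ Dm Dp : Plane →L[ℝ] ℂ,
    Tendsto (fderiv ℝ u) (𝓝[inside R ρ₀] (ell R ρ₀ ω)) (𝓝 Dm) ∧
    Tendsto (fderiv ℝ u) (𝓝[outside R ρ₀] (ell R ρ₀ ω)) (𝓝 Dp) ∧
    (εm : ℂ) * Dp (unitNormal ρ₀ ω) = εin * Dm (unitNormal ρ₀ ω)
  decay : u =O[cocompact Plane] (fun x : Plane => ‖x‖⁻¹)

end EllipseResonance

end

/-! The map `ρ + iω ↦ R cosh(ρ + iω)` is conformal, so in elliptic coordinates Laplace's equation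
keeps its form, and the coefficients of a harmonic function against `cos nω` and `sin nω` solve `y''
= n² y` in `ρ`. In the ellipse, invariance of `ell` under `(ρ, ω) ↦ (-ρ, -ω)` leaves only `cosh nρ`
for cosines and `sinh nρ` for sines (`exists_coeff_eq_hyp`). Outside, decay leaves only `e^{-nρ}`
for the reflected field `w = u - F_z` (`exists_coeff_eq_exp_neg`). On ellipses not reaching `z` the
dipole has coefficients `fₙ cosh nρ` or `fₙ sinh nρ` with `|fₙ| ≤ C e^{-nρ_z}`
(`exists_integral_dipole`).

Continuity and the flux condition at `ρ₀` give a 2×2 linear system for each mode. The amplitude `bₙ`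
of the reflected mode at `ρ₀` has, up to a factor, the denominator `(ε_in + ε_m) ± (ε_m - ε_in)
e^{-2nρ₀}`. For both families of permittivities its modulus is at least a constant times `|ε_m -
ε_in| e^{-2nρ₀}`, uniformly in `δ` (`norm_sub_mul_le_of_permittivity`), whence `|bₙ| ≤ K |fₙ|
e^{3nρ₀}` (`norm_reflected_le`).

Outside, the mode is `bₙ e^{-n(ρ-ρ₀)}`; inside, it is at most `|bₙ|`. In both cases it is bounded by
`K C e^{-n(ρ+ρ_z-4ρ₀)}`, and the mean vanishes. Summing the Fourier series on each ellipse
(`norm_le_tsum_of_trig_coeff_le`) gives the first claim; the second follows because the bound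
decreases in `ρ`. -/

open Filter Topology Set

namespace EllipseResonance

/-! ### Integrals over the angle as functions of the elliptic radius. -/

section ParametricIntegrals

theorem continuousOn_intervalIntegral_param {X : Type*} [TopologicalSpace X]
    [FirstCountableTopology X] {I : Set X} {g : X → ℝ → ℂ}
    (hg : ContinuousOn (Function.uncurry g) (I ×ˢ univ)) (a b : ℝ) :
    ContinuousOn (fun x => ∫ ω in a..b, g x ω) I := by
  rw [continuousOn_iff_continuous_domRestrict]
  refine intervalIntegral.continuous_parametric_intervalIntegral_of_continuous'
    (f := fun (x : I) ω => g x ω) ?_ a b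
  exact hg.comp_continuous (f := fun p : I × ℝ => ((p.1 : X), p.2)) (by fun_prop)
    fun p => ⟨p.1.2, mem_univ _⟩

/-- Pointwise boundary limits of a continuous family, taken jointly in both variables, may be
integrated. -/
theorem tendsto_intervalIntegral_boundary {I : Set ℝ} {e : ℝ} (he : e ∈ closure I)
    {g : ℝ → ℝ → ℂ} (hg : ContinuousOn (Function.uncurry g) (I ×ˢ univ)) {D : ℝ → ℂ}
    (hD : ∀ ω, Tendsto (Function.uncurry g) (𝓝[I ×ˢ univ] (e, ω)) (𝓝 (D ω))) (a b : ℝ) :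
    Tendsto (fun ρ => ∫ ω in a..b, g ρ ω) (𝓝[I] e) (𝓝 (∫ ω in a..b, D ω)) := by
  set S : Set (ℝ × ℝ) := I ×ˢ univ with hS
  have hcl : ∀ ω : ℝ, (e, ω) ∈ closure S := fun ω => by
    rw [hS, closure_prod_eq]; exact ⟨he, by simp⟩
  -- The joint limits extend `g` continuously to the edge `{e} × ℝ`, which replaces any domination
  -- argument.
  have hcont : ContinuousOn (extendFrom S (Function.uncurry g)) (insert e I ×ˢ univ) := by
    refine continuousOn_extendFrom ?_ ?_
    · rintro ⟨ρ, ω⟩ ⟨hρ, -⟩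
      rcases hρ with rfl | hρ
      · exact hcl ω
      · exact subset_closure ⟨hρ, mem_univ _⟩
    · rintro ⟨ρ, ω⟩ ⟨hρ, -⟩
      rcases hρ with rfl | hρ
      · exact ⟨_, hD ω⟩
      · exact ⟨_, hg _ ⟨hρ, mem_univ _⟩⟩
  have h1 := continuousOn_intervalIntegral_param
    (g := fun ρ ω => extendFrom S (Function.uncurry g) (ρ, ω)) hcont a b e (mem_insert _ _)
  have h2 : ∫ ω in a..b, extendFrom S (Function.uncurry g) (e, ω) = ∫ ω in a..b, D ω :=
    intervalIntegral.integral_congr fun ω _ => extendFrom_eq (hcl ω) (hD ω)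
  have h3 := h1.tendsto.mono_left (nhdsWithin_mono e (subset_insert e I))
  simp only [h2] at h3
  refine h3.congr' ?_
  filter_upwards [self_mem_nhdsWithin] with ρ hρ
  exact intervalIntegral.integral_congr fun ω _ => extendFrom_extends hg (ρ, ω) ⟨hρ, mem_univ _⟩

theorem hasDerivAt_intervalIntegral_param {I : Set ℝ} (hI : IsOpen I) {g g' : ℝ → ℝ → ℂ}
    (hg : ContinuousOn (Function.uncurry g) (I ×ˢ univ))
    (hg' : ContinuousOn (Function.uncurry g') (I ×ˢ univ))
    (hd : ∀ ρ ∈ I, ∀ ω, HasDerivAt (fun r => g r ω) (g' ρ ω) ρ) (a b : ℝ) {ρ : ℝ} (hρ : ρ ∈ I) :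
    HasDerivAt (fun r => ∫ ω in a..b, g r ω) (∫ ω in a..b, g' ρ ω) ρ := by
  obtain ⟨ε, hε, hball⟩ := Metric.isOpen_iff.1 hI ρ hρ
  have hsub : Metric.closedBall ρ (ε / 2) ⊆ I :=
    (Metric.closedBall_subset_ball (by linarith)).trans hball
  -- Joint continuity of `g'` on a compact rectangle supplies the dominating constant.
  obtain ⟨C, hC⟩ := ((isCompact_closedBall ρ (ε / 2)).prod
    (isCompact_uIcc (a := a) (b := b))).exists_bound_of_continuousOn
      (hg'.mono (prod_mono hsub (subset_univ _)))
  have hslice : ∀ {h : ℝ → ℝ → ℂ}, ContinuousOn (Function.uncurry h) (I ×ˢ univ) →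
      ∀ r ∈ I, Continuous (h r) := fun {h} hh r hr =>
    hh.comp_continuous (f := fun ω : ℝ => (r, ω)) (by fun_prop) fun ω => ⟨hr, mem_univ _⟩
  refine (intervalIntegral.hasDerivAt_integral_of_dominated_loc_of_deriv_le
    (bound := fun _ => C) (s := Metric.closedBall ρ (ε / 2))
    (Metric.closedBall_mem_nhds ρ (by linarith)) ?_ ?_ ?_ ?_ ?_ ?_).2
  · filter_upwards [hI.mem_nhds hρ] with r hr
    exact (hslice hg r hr).aestronglyMeasurable
  · exact (hslice hg ρ hρ).intervalIntegrable _ _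
  · exact (hslice hg' ρ hρ).aestronglyMeasurable
  · exact .of_forall fun ω hω r hr => hC (r, ω) ⟨hr, uIoc_subset_uIcc hω⟩
  · exact intervalIntegrable_const
  · exact .of_forall fun ω _ r hr => hd r (hsub hr) ω

end ParametricIntegrals

/-! ### The equations `y'' = k² y` and `y'' = 0` on an interval. -/

section Ode

theorem exists_const_of_hasDerivAt_zero {s : Set ℝ} (hs : IsOpen s) (hs' : IsPreconnected s)
    {f : ℝ → ℂ} (hf : ∀ x ∈ s, HasDerivAt f 0 x) : ∃ c, ∀ x ∈ s, f x = c := by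
  rcases s.eq_empty_or_nonempty with rfl | ⟨x₀, hx₀⟩
  · exact ⟨0, by simp⟩
  · exact ⟨f x₀, fun x hx => hs.is_const_of_deriv_eq_zero hs'
      (fun y hy => (hf y hy).differentiableAt.differentiableWithinAt)
      (fun y hy => (hf y hy).deriv) hx hx₀⟩

/-- Factoring `y'' - k² y` as `(d/dx ∓ k)(d/dx ± k) y` shows that `(y' + k y) e^{-kx}` and `(y' - k
y) e^{kx}` are constant; their combination recovers `y`. -/
theorem exists_exp_of_hasDerivAt {s : Set ℝ} (hs : IsOpen s) (hs' : IsPreconnected s)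
    {y y' : ℝ → ℂ} {k : ℝ} (hk : k ≠ 0) (h1 : ∀ x ∈ s, HasDerivAt y (y' x) x)
    (h2 : ∀ x ∈ s, HasDerivAt y' ((k : ℂ) ^ 2 * y x) x) :
    ∃ A B : ℂ, ∀ x ∈ s, y x = A * Real.exp (k * x) + B * Real.exp (-(k * x)) := by
  have hkc : (k : ℂ) ≠ 0 := by exact_mod_cast hk
  have hexp : ∀ (c x : ℝ),
      HasDerivAt (fun t : ℝ => ((Real.exp (c * t) : ℝ) : ℂ)) (c * Real.exp (c * x)) x := by
    intro c x
    have := (((hasDerivAt_id x).const_mul c).exp).ofReal_comp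
    refine this.congr_deriv ?_
    simp only [id, mul_one]; push_cast; ring
  obtain ⟨A, hA⟩ := exists_const_of_hasDerivAt_zero hs hs'
    (f := fun x => (y' x + k * y x) * Real.exp (-k * x)) fun x hx => by
      refine (((h2 x hx).add ((h1 x hx).const_mul (k : ℂ))).mul (hexp (-k) x)).congr_deriv ?_
      simp only [Pi.add_apply, Complex.ofReal_neg]; ring
  obtain ⟨B, hB⟩ := exists_const_of_hasDerivAt_zero hs hs'
    (f := fun x => (y' x - k * y x) * Real.exp (k * x)) fun x hx => by
      refine (((h2 x hx).sub ((h1 x hx).const_mul (k : ℂ))).mul (hexp k x)).congr_deriv ?_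
      simp only [Pi.sub_apply]; ring
  refine ⟨A / (2 * k), -B / (2 * k), fun x hx => ?_⟩
  have hmul : ((Real.exp (k * x) : ℝ) : ℂ) * Real.exp (-(k * x)) = 1 := by
    rw [← Complex.ofReal_mul, ← Real.exp_add]; simp
  rw [← hA x hx, ← hB x hx, neg_mul]
  field_simp
  linear_combination (-(2 * k * y x)) * hmul

theorem exists_affine_of_hasDerivAt {s : Set ℝ} (hs : IsOpen s) (hs' : IsPreconnected s)
    {y y' : ℝ → ℂ} (h1 : ∀ x ∈ s, HasDerivAt y (y' x) x) (h2 : ∀ x ∈ s, HasDerivAt y' 0 x) :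
    ∃ A B : ℂ, ∀ x ∈ s, y x = A + B * x := by
  obtain ⟨B, hB⟩ := exists_const_of_hasDerivAt_zero hs hs' h2
  obtain ⟨A, hA⟩ := exists_const_of_hasDerivAt_zero hs hs' (f := fun x => y x - B * x)
    fun x hx => by
      refine ((h1 x hx).sub ((hasDerivAt_id x).ofReal_comp.const_mul B)).congr_deriv ?_
      simp [hB x hx]
  exact ⟨A, B, fun x hx => by rw [← hA x hx]; ring⟩

end Ode

/-! ### Pointwise bounds from trigonometric coefficients. -/

section Fourier

open Real in
/-- A continuous periodic function is bounded by the sum of bounds for its trigonometric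
coefficients. -/
theorem norm_le_tsum_of_trig_coeff_le {f : ℝ → ℂ} (hf : Continuous f)
    (hper : Function.Periodic f (2 * π)) (h0 : ∫ ω in (0 : ℝ)..2 * π, f ω = 0) {M : ℕ → ℝ}
    (hM : Summable M)
    (hc : ∀ n : ℕ, ‖∫ ω in (0 : ℝ)..2 * π, f ω * (cos ((n + 1 : ℕ) * ω) : ℝ)‖ ≤ M n)
    (hs : ∀ n : ℕ, ‖∫ ω in (0 : ℝ)..2 * π, f ω * (sin ((n + 1 : ℕ) * ω) : ℝ)‖ ≤ M n) (ω : ℝ) :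
    ‖f ω‖ ≤ 2 / π * ∑' n, M n := by
  have hpi := Real.pi_pos
  have : Fact (0 < 2 * π) := ⟨by positivity⟩
  let F : C(AddCircle (2 * π), ℂ) :=
    ⟨hper.lift, continuous_coinduced_dom.mpr hf⟩
  have hF : ∀ x : ℝ, F (x : AddCircle (2 * π)) = f x := fun x => rfl
  have hcoef : ∀ n : ℤ, fourierCoeff F n = (1 / (2 * π) : ℝ) •
      ((∫ ω in (0 : ℝ)..2 * π, f ω * (cos (n * ω) : ℝ)) -
        Complex.I * ∫ ω in (0 : ℝ)..2 * π, f ω * (sin (n * ω) : ℝ)) := by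
    intro n
    rw [fourierCoeff_eq_intervalIntegral _ _ 0, ← intervalIntegral.integral_const_mul,
      ← intervalIntegral.integral_sub, zero_add]
    · congr 1
      refine intervalIntegral.integral_congr fun x _ => ?_
      simp only [hF, fourier_coe_apply, smul_eq_mul]
      have : 2 * (π : ℂ) * Complex.I * ((-n : ℤ) : ℂ) * x / ((2 * π : ℝ) : ℂ)
          = ((-(n * x) : ℝ) : ℂ) * Complex.I := by
        have : (π : ℂ) ≠ 0 := by exact_mod_cast hpi.ne'
        push_cast; field_simp
      rw [this, Complex.exp_mul_I, ← Complex.ofReal_cos, ← Complex.ofReal_sin, Real.cos_neg,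
        Real.sin_neg]
      push_cast; ring
    · exact Continuous.intervalIntegrable (by fun_prop) _ _
    · exact Continuous.intervalIntegrable (by fun_prop) _ _
  -- A cosine and a sine integral, each at most `M n`, with the factor `1/(2π)`, give `M n / π`;
  -- positive and negative frequencies together account for the constant `2/π`.
  have hpos : ∀ n : ℕ, ‖fourierCoeff F ((n : ℤ) + 1)‖ ≤ M n / π := by
    intro n
    have hc := hc n
    have hs := hs n
    simp only [Nat.cast_add, Nat.cast_one] at hc hs
    rw [hcoef, norm_smul, Real.norm_of_nonneg (by positivity)]
    simp only [Int.cast_add, Int.cast_natCast, Int.cast_one]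
    calc _ ≤ 1 / (2 * π) * (M n + M n) := by
          gcongr
          refine (norm_sub_le _ _).trans (add_le_add hc ?_)
          rw [norm_mul, Complex.norm_I, one_mul]; exact hs
      _ = M n / π := by field_simp; ring
  have hneg : ∀ n : ℕ, ‖fourierCoeff F (-((n : ℤ) + 1))‖ ≤ M n / π := by
    intro n
    have hc := hc n
    have hs := hs n
    simp only [Nat.cast_add, Nat.cast_one] at hc hs
    rw [hcoef, norm_smul, Real.norm_of_nonneg (by positivity)]
    have e : ∀ x : ℝ, ((-((n : ℤ) + 1) : ℤ) : ℝ) * x = -((n + 1) * x) := fun x => by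
      push_cast; ring
    simp only [e, Real.cos_neg, Real.sin_neg, Complex.ofReal_neg, mul_neg,
      intervalIntegral.integral_neg]
    calc _ ≤ 1 / (2 * π) * (M n + M n) := by
          gcongr
          rw [sub_neg_eq_add]
          refine (norm_add_le _ _).trans (add_le_add hc ?_)
          rw [norm_mul, Complex.norm_I, one_mul]; exact hs
      _ = M n / π := by field_simp; ring
  have hzero : fourierCoeff F 0 = 0 := by
    rw [hcoef]; simp [h0]
  have hMp : Summable fun n => M n / π := hM.div_const π
  have hs1 : Summable fun n : ℕ => ‖fourierCoeff F ((n : ℤ) + 1)‖ :=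
    Summable.of_nonneg_of_le (fun _ => norm_nonneg _) hpos hMp
  have hs2 : Summable fun n : ℕ => ‖fourierCoeff F (-((n : ℤ) + 1))‖ :=
    Summable.of_nonneg_of_le (fun _ => norm_nonneg _) hneg hMp
  have hsn : Summable fun n : ℤ => ‖fourierCoeff F n‖ :=
    Summable.of_add_one_of_neg_add_one hs1 hs2
  have hsum := has_pointwise_sum_fourier_series_of_summable hsn.of_norm (ω : AddCircle (2 * π))
  rw [← hF ω, ← hsum.tsum_eq]
  have hnorm : ∀ n : ℤ, ‖fourierCoeff F n • fourier n (ω : AddCircle (2 * π))‖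
      = ‖fourierCoeff F n‖ := fun n => by
    rw [norm_smul, fourier_apply, Circle.norm_coe, mul_one]
  calc _ ≤ ∑' n : ℤ, ‖fourierCoeff F n • fourier n (ω : AddCircle (2 * π))‖ :=
        norm_tsum_le_tsum_norm (by simpa only [hnorm] using hsn)
    _ = ∑' n : ℤ, ‖fourierCoeff F n‖ := by simp only [hnorm]
    _ = ∑' n : ℕ, ‖fourierCoeff F ((n : ℤ) + 1)‖ + ‖fourierCoeff F 0‖ +
          ∑' n : ℕ, ‖fourierCoeff F (-((n : ℤ) + 1))‖ := tsum_of_add_one_of_neg_add_one hs1 hs2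
    _ ≤ ∑' n, M n / π + 0 + ∑' n, M n / π := by
        gcongr
        · exact hpos _
        · rw [hzero, norm_zero]
        · exact hneg _
    _ = 2 / π * ∑' n, M n := by rw [tsum_div_const]; ring

end Fourier

end EllipseResonance

namespace EllipseResonance

/-! ### Geometry of elliptic coordinates. -/

section EllipticCoordinates

/-- The derivative of `ell` in the direction of the elliptic radius. -/
noncomputable def ellRho (R ρ ω : ℝ) : Plane :=
  !₂[R * Real.cos ω * Real.sinh ρ, R * Real.sin ω * Real.cosh ρ]

/-- The derivative of `ell` in the direction of the elliptic angle. -/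
noncomputable def ellOmega (R ρ ω : ℝ) : Plane :=
  !₂[-(R * Real.sin ω * Real.cosh ρ), R * Real.cos ω * Real.sinh ρ]

theorem hasDerivAt_toPlane {f g : ℝ → ℝ} {f' g' x : ℝ} (hf : HasDerivAt f f' x)
    (hg : HasDerivAt g g' x) :
    HasDerivAt (fun t => (!₂[f t, g t] : Plane)) !₂[f', g'] x := by
  have h : HasDerivAt (fun t => ![f t, g t]) ![f', g'] x := by
    rw [hasDerivAt_pi]
    intro i
    fin_cases i
    · exact hf
    · exact hg
  exact (PiLp.continuousLinearEquiv 2 ℝ fun _ : Fin 2 => ℝ).symm.hasFDerivAt.comp_hasDerivAt x h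

theorem hasDerivAt_ell_rho (R ρ ω : ℝ) :
    HasDerivAt (fun r => ell R r ω) (ellRho R ρ ω) ρ :=
  hasDerivAt_toPlane ((Real.hasDerivAt_cosh ρ).const_mul _) ((Real.hasDerivAt_sinh ρ).const_mul _)

theorem hasDerivAt_ellRho_rho (R ρ ω : ℝ) :
    HasDerivAt (fun r => ellRho R r ω) (ell R ρ ω) ρ :=
  hasDerivAt_toPlane ((Real.hasDerivAt_sinh ρ).const_mul _) ((Real.hasDerivAt_cosh ρ).const_mul _)

theorem hasDerivAt_ell_omega (R ρ ω : ℝ) :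
    HasDerivAt (fun t => ell R ρ t) (ellOmega R ρ ω) ω := by
  refine hasDerivAt_toPlane ?_ ?_
  · exact (((Real.hasDerivAt_cos ω).const_mul R).mul_const _).congr_deriv (by ring)
  · exact ((Real.hasDerivAt_sin ω).const_mul R).mul_const _

theorem hasDerivAt_ellOmega_omega (R ρ ω : ℝ) :
    HasDerivAt (fun t => ellOmega R ρ t) (-ell R ρ ω) ω := by
  have : -ell R ρ ω =
      !₂[-(R * Real.cos ω * Real.cosh ρ), -(R * Real.sin ω * Real.sinh ρ)] := by
    ext i; fin_cases i <;> simp [ell]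
  rw [this]
  refine hasDerivAt_toPlane ?_ ?_
  · exact (((Real.hasDerivAt_sin ω).const_mul R).mul_const _).neg
  · exact (((Real.hasDerivAt_cos ω).const_mul R).mul_const _).congr_deriv (by ring)

theorem continuous_toPlane {X : Type*} [TopologicalSpace X] {f g : X → ℝ} (hf : Continuous f)
    (hg : Continuous g) : Continuous fun x => (!₂[f x, g x] : Plane) := by
  refine (PiLp.continuous_toLp 2 _).comp (continuous_pi fun i => ?_)
  fin_cases i
  · exact hf
  · exact hg

theorem continuous_ell (R : ℝ) : Continuous fun p : ℝ × ℝ => ell R p.1 p.2 :=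
  continuous_toPlane (by fun_prop) (by fun_prop)

theorem continuous_ellRho (R : ℝ) : Continuous fun p : ℝ × ℝ => ellRho R p.1 p.2 :=
  continuous_toPlane (by fun_prop) (by fun_prop)

theorem ell_neg_neg (R ρ ω : ℝ) : ell R (-ρ) (-ω) = ell R ρ ω := by simp [ell]

theorem ell_add_two_pi (R ρ ω : ℝ) : ell R ρ (ω + 2 * Real.pi) = ell R ρ ω := by simp [ell]

theorem ellOmega_add_two_pi (R ρ ω : ℝ) :
    ellOmega R ρ (ω + 2 * Real.pi) = ellOmega R ρ ω := by simp [ellOmega]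

/-- Radial derivatives are normal derivatives up to a scale factor common to both sides of the
boundary, so the flux condition may be stated for `∂/∂ρ`. -/
theorem ellRho_eq_smul_unitNormal (R : ℝ) {ρ : ℝ} (hρ : 0 < ρ) (ω : ℝ) :
    ellRho R ρ ω = (R * Real.sqrt (Real.sinh ρ ^ 2 + Real.sin ω ^ 2)) • unitNormal ρ ω := by
  have h : Real.sqrt (Real.sinh ρ ^ 2 + Real.sin ω ^ 2) ≠ 0 := by
    have := Real.sinh_pos_iff.2 hρ
    positivity
  rw [unitNormal, smul_smul, mul_assoc, mul_inv_cancel₀ h, mul_one]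
  ext i; fin_cases i <;> simp [ellRho, mul_assoc]

/-- The elliptic radius is determined by the point. -/
theorem abs_eq_of_ell_eq {R : ℝ} (hR : 0 < R) {ρ ω ρ' ω' : ℝ} (h : ell R ρ ω = ell R ρ' ω') :
    |ρ| = |ρ'| := by
  have h0 : R * Real.cos ω * Real.cosh ρ = R * Real.cos ω' * Real.cosh ρ' := by
    simpa [ell] using congrArg (fun x : Plane => x 0) h
  have h1 : R * Real.sin ω * Real.sinh ρ = R * Real.sin ω' * Real.sinh ρ' := by
    simpa [ell] using congrArg (fun x : Plane => x 1) h
  replace h0 : Real.cos ω * Real.cosh ρ = Real.cos ω' * Real.cosh ρ' :=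
    mul_left_cancel₀ hR.ne' (by linarith)
  replace h1 : Real.sin ω * Real.sinh ρ = Real.sin ω' * Real.sinh ρ' :=
    mul_left_cancel₀ hR.ne' (by linarith)
  -- Here `c = cosh² ρ` and `t = cos² ω`: their sum and product are determined by the point, so they
  -- are the roots of one quadratic, told apart by `t ≤ 1 ≤ c`.
  have key : ∀ {c t c' t' : ℝ}, c * t = c' * t' → c + t = c' + t' → t ≤ 1 → t' ≤ 1 → 1 ≤ c →
      1 ≤ c' → c = c' := by
    intro c t c' t' hm ha ht ht' hc hc'
    have : (c' - c) * (c' - t) = 0 := by linear_combination hm - c' * ha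
    rcases mul_eq_zero.1 this with h | h <;> linarith
  have hcs := Real.sin_sq_add_cos_sq ω
  have hcs' := Real.sin_sq_add_cos_sq ω'
  have hh := Real.cosh_sq ρ
  have hh' := Real.cosh_sq ρ'
  have hm : Real.cosh ρ ^ 2 * Real.cos ω ^ 2 = Real.cosh ρ' ^ 2 * Real.cos ω' ^ 2 := by
    rw [← mul_pow, ← mul_pow, mul_comm, h0, mul_comm]
  have ha : Real.cosh ρ ^ 2 + Real.cos ω ^ 2 = Real.cosh ρ' ^ 2 + Real.cos ω' ^ 2 := by
    have : Real.sin ω ^ 2 * Real.sinh ρ ^ 2 = Real.sin ω' ^ 2 * Real.sinh ρ' ^ 2 := by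
      rw [← mul_pow, ← mul_pow, h1]
    have e : ∀ {s c H S : ℝ}, s + c = 1 → H = S + 1 → H + c = s * S + H * c + 1 := by
      intro s c H S hs hH
      rw [hH, show s = 1 - c by linarith]; ring
    rw [e hcs hh, e hcs' hh']
    linarith
  have := key hm ha (Real.cos_sq_le_one _) (Real.cos_sq_le_one _)
    (by nlinarith [sq_nonneg (Real.sinh ρ)]) (by nlinarith [sq_nonneg (Real.sinh ρ')])
  have hc : Real.cosh ρ = Real.cosh ρ' :=
    (pow_left_inj₀ (Real.cosh_pos _).le (Real.cosh_pos _).le two_ne_zero).1 this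
  exact le_antisymm (Real.cosh_le_cosh.1 hc.le) (Real.cosh_le_cosh.1 hc.ge)

theorem ell_mem_inside {R ρ₀ ρ : ℝ} (h : |ρ| < ρ₀) (ω : ℝ) : ell R ρ ω ∈ inside R ρ₀ := by
  rcases le_total 0 ρ with hρ | hρ
  · exact ⟨ρ, ω, hρ, (le_abs_self ρ).trans_lt h, rfl⟩
  · exact ⟨-ρ, -ω, by linarith, (neg_le_abs ρ).trans_lt h, (ell_neg_neg R ρ ω).symm⟩

theorem ell_mem_outside {R ρ₀ ρ : ℝ} (h : ρ₀ < ρ) (ω : ℝ) : ell R ρ ω ∈ outside R ρ₀ :=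
  ⟨ρ, ω, h, rfl⟩

/-- The complex cosine is surjective, and the real and imaginary parts of `cos c` are elliptic
coordinates with `ρ = Im c`, `ω = -Re c`; the symmetry `ell_neg_neg` makes `ρ` nonnegative. -/
theorem exists_ell_eq {R : ℝ} (hR : 0 < R) (x : Plane) : ∃ ρ ω : ℝ, 0 ≤ ρ ∧ x = ell R ρ ω := by
  obtain ⟨c, hc⟩ := Complex.cos_surjective (⟨x 0 / R, x 1 / R⟩ : ℂ)
  have hre : Real.cos c.re * Real.cosh c.im = x 0 / R := by
    have := congrArg Complex.re hc
    rw [Complex.cos_eq] at this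
    simpa [← Complex.ofReal_cos, ← Complex.ofReal_sin, ← Complex.ofReal_cosh,
      ← Complex.ofReal_sinh] using this
  have him : -(Real.sin c.re * Real.sinh c.im) = x 1 / R := by
    have := congrArg Complex.im hc
    rw [Complex.cos_eq] at this
    simpa [← Complex.ofReal_cos, ← Complex.ofReal_sin, ← Complex.ofReal_cosh,
      ← Complex.ofReal_sinh] using this
  have hx : x = ell R c.im (-c.re) := by
    ext i
    fin_cases i
    · simp only [ell, Real.cos_neg, Fin.zero_eta, PiLp.toLp_apply, Matrix.cons_val_zero]
      rw [mul_assoc, hre]; field_simp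
    · simp only [ell, Real.sin_neg, Fin.mk_one, PiLp.toLp_apply, Matrix.cons_val_one]
      rw [mul_assoc, neg_mul, him]; simp; field_simp
  rcases le_total 0 c.im with h | h
  · exact ⟨c.im, -c.re, h, hx⟩
  · exact ⟨-c.im, c.re, by linarith, by rw [hx, ← ell_neg_neg, neg_neg]⟩

theorem isOpen_outside {R ρ₀ : ℝ} (hR : 0 < R) (hρ₀ : 0 < ρ₀) : IsOpen (outside R ρ₀) := by
  have hs := Real.sinh_pos_iff.2 hρ₀
  have hc := Real.cosh_pos ρ₀
  -- The exterior is cut out by the Cartesian equation of the ellipse with semi-axes `R cosh ρ₀` and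
  -- `R sinh ρ₀`.
  have : outside R ρ₀ =
      {x : Plane | R ^ 2 < (x 0 / Real.cosh ρ₀) ^ 2 + (x 1 / Real.sinh ρ₀) ^ 2} := by
    have key : ∀ ρ ω, ((ell R ρ ω) 0 / Real.cosh ρ₀) ^ 2 + ((ell R ρ ω) 1 / Real.sinh ρ₀) ^ 2
        = R ^ 2 * (Real.cos ω ^ 2 * (Real.cosh ρ / Real.cosh ρ₀) ^ 2 +
          Real.sin ω ^ 2 * (Real.sinh ρ / Real.sinh ρ₀) ^ 2) := fun ρ ω => by
      simp only [ell, PiLp.toLp_apply, Matrix.cons_val_zero, Matrix.cons_val_one]; ring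
    ext x
    constructor
    · rintro ⟨ρ, ω, hρ, rfl⟩
      have h1 : 1 < (Real.cosh ρ / Real.cosh ρ₀) ^ 2 := by
        apply one_lt_pow₀ _ two_ne_zero
        rw [one_lt_div hc]
        exact Real.cosh_lt_cosh.2 (by rwa [abs_of_pos hρ₀, abs_of_pos (hρ₀.trans hρ)])
      have h2 : 1 < (Real.sinh ρ / Real.sinh ρ₀) ^ 2 := by
        apply one_lt_pow₀ _ two_ne_zero
        rw [one_lt_div hs]
        exact Real.sinh_lt_sinh.2 hρ
      rw [mem_ofPred_eq, key]
      refine lt_mul_of_one_lt_right (by positivity) ?_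
      have hcs := Real.sin_sq_add_cos_sq ω
      rcases le_total ((Real.cosh ρ / Real.cosh ρ₀) ^ 2) ((Real.sinh ρ / Real.sinh ρ₀) ^ 2)
        with h | h
      · nlinarith [mul_nonneg (sq_nonneg (Real.sin ω)) (sub_nonneg.2 h)]
      · nlinarith [mul_nonneg (sq_nonneg (Real.cos ω)) (sub_nonneg.2 h)]
    · intro hx
      obtain ⟨ρ, ω, hρ, rfl⟩ := exists_ell_eq hR x
      refine ⟨ρ, ω, ?_, rfl⟩
      by_contra hle
      push Not at hle
      rw [mem_ofPred_eq, key] at hx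
      have h1 : (Real.cosh ρ / Real.cosh ρ₀) ^ 2 ≤ 1 := by
        apply pow_le_one₀ (by have := Real.cosh_pos ρ; positivity)
        rw [div_le_one hc]
        exact Real.cosh_le_cosh.2 (by rwa [abs_of_pos hρ₀, abs_of_nonneg hρ])
      have h2 : (Real.sinh ρ / Real.sinh ρ₀) ^ 2 ≤ 1 := by
        apply pow_le_one₀ (div_nonneg (Real.sinh_nonneg_iff.2 hρ) hs.le)
        rw [div_le_one hs]
        exact Real.sinh_le_sinh.2 hle
      refine absurd hx (not_lt.2 (mul_le_of_le_one_right (by positivity) ?_))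
      nlinarith [Real.sin_sq_add_cos_sq ω, sq_nonneg (Real.sin ω), sq_nonneg (Real.cos ω)]
  rw [this]
  exact isOpen_lt continuous_const (by fun_prop)

/-- Since `|x|² = R² (sinh² ρ + cos² ω)`, decay in `|x|` becomes decay in `ρ` uniformly in `ω`. -/
theorem norm_ell_ge {R ρ : ℝ} (hR : 0 < R) (hρ : 0 ≤ ρ) (ω : ℝ) :
    R * Real.sinh ρ ≤ ‖ell R ρ ω‖ := by
  have hs := Real.sinh_nonneg_iff.2 hρ
  rw [EuclideanSpace.norm_eq]
  apply Real.le_sqrt_of_sq_le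
  simp only [ell, PiLp.toLp_apply, Fin.sum_univ_two, Matrix.cons_val_zero, Matrix.cons_val_one,
    Real.norm_eq_abs, sq_abs]
  have : (R * Real.cos ω * Real.cosh ρ) ^ 2 + (R * Real.sin ω * Real.sinh ρ) ^ 2
      = R ^ 2 * (Real.sinh ρ ^ 2 + Real.cos ω ^ 2) := by
    have := Real.cosh_sq ρ
    have := Real.sin_sq ω
    rw [mul_pow, mul_pow, mul_pow, mul_pow, Real.cosh_sq, Real.sin_sq]; ring
  rw [this, mul_pow]
  gcongr
  nlinarith [sq_nonneg (Real.cos ω)]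

end EllipticCoordinates

/-! ### The Laplace equation in elliptic coordinates. -/

section HarmonicFunctions

/-- Conformality: the coordinate vectors are `(p, q)` and `(-q, p)`, orthogonal and of equal length,
so the sum is `(p² + q²) Δf`. -/
theorem fderiv_fderiv_ell_add {f : Plane → ℂ} (R ρ ω : ℝ)
    (hf : InnerProductSpace.HarmonicAt f (ell R ρ ω)) :
    fderiv ℝ (fderiv ℝ f) (ell R ρ ω) (ellRho R ρ ω) (ellRho R ρ ω) +
      fderiv ℝ (fderiv ℝ f) (ell R ρ ω) (ellOmega R ρ ω) (ellOmega R ρ ω) = 0 := by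
  have hL := hf.2.self_of_nhds
  rw [InnerProductSpace.laplacian_eq_iteratedFDeriv_orthonormalBasis f
    (EuclideanSpace.basisFun (Fin 2) ℝ)] at hL
  simp only [Fin.sum_univ_two, iteratedFDeriv_two_apply, Pi.zero_apply, Matrix.cons_val_zero,
    Matrix.cons_val_one, EuclideanSpace.basisFun_apply] at hL
  set p := R * Real.cos ω * Real.sinh ρ
  set q := R * Real.sin ω * Real.cosh ρ
  have h1 : ellRho R ρ ω =
      p • EuclideanSpace.single (0 : Fin 2) (1 : ℝ) + q • EuclideanSpace.single (1 : Fin 2) 1 := by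
    ext i; fin_cases i <;> simp [ellRho, p, q]
  have h2 : ellOmega R ρ ω =
      (-q) • EuclideanSpace.single (0 : Fin 2) (1 : ℝ) +
        p • EuclideanSpace.single (1 : Fin 2) 1 := by
    ext i; fin_cases i <;> simp [ellOmega, p, q]
  rw [h1, h2]
  simp only [map_add, map_smul, add_apply, smul_apply,
    Complex.real_smul, Complex.ofReal_neg]
  linear_combination ((p : ℂ) ^ 2 + (q : ℂ) ^ 2) * hL

variable {f : Plane → ℂ} {R : ℝ} {s : Set ℝ}

theorem continuousOn_fderiv_ell (hf : ∀ ρ ∈ s, ∀ ω, ContDiffAt ℝ 1 f (ell R ρ ω)) :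
    ContinuousOn (fun p : ℝ × ℝ => fderiv ℝ f (ell R p.1 p.2)) (s ×ˢ univ) := fun p hp =>
  (ContinuousAt.comp (g := fderiv ℝ f) (f := fun p : ℝ × ℝ => ell R p.1 p.2)
    ((hf p.1 hp.1 p.2).fderiv_right (m := 0) (by norm_num)).continuousAt
    (continuous_ell R).continuousAt).continuousWithinAt

theorem continuousOn_comp_ell (hf : ∀ ρ ∈ s, ∀ ω, ContinuousAt f (ell R ρ ω)) :
    ContinuousOn (fun p : ℝ × ℝ => f (ell R p.1 p.2)) (s ×ˢ univ) := fun p hp =>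
  (ContinuousAt.comp (g := f) (f := fun p : ℝ × ℝ => ell R p.1 p.2)
    (hf p.1 hp.1 p.2) (continuous_ell R).continuousAt).continuousWithinAt

theorem hasDerivAt_integral_comp_ell (hs : IsOpen s)
    (hf : ∀ ρ ∈ s, ∀ ω, ContDiffAt ℝ 1 f (ell R ρ ω)) {φ : ℝ → ℝ} (hφ : Continuous φ) (a b : ℝ)
    {ρ : ℝ} (hρ : ρ ∈ s) :
    HasDerivAt (fun r => ∫ ω in a..b, f (ell R r ω) * φ ω)
      (∫ ω in a..b, fderiv ℝ f (ell R ρ ω) (ellRho R ρ ω) * φ ω) ρ := by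
  refine hasDerivAt_intervalIntegral_param hs (g := fun r ω => f (ell R r ω) * φ ω)
    (g' := fun r ω => fderiv ℝ f (ell R r ω) (ellRho R r ω) * φ ω) ?_ ?_ ?_ a b hρ
  · exact (continuousOn_comp_ell fun ρ hρ ω => (hf ρ hρ ω).continuousAt).mul (by fun_prop)
  · exact ((continuousOn_fderiv_ell hf).clm_apply (continuous_ellRho R).continuousOn).mul
      (by fun_prop)
  · intro r hr ω
    exact (((hf r hr ω).differentiableAt (by norm_num)).hasFDerivAt.comp_hasDerivAt r
      (hasDerivAt_ell_rho R r ω)).mul_const _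

/-- If `g` solves the Laplace equation in a strip, is periodic and `φ'' = -k² φ`, then
`∫ g φ` solves `y'' = k² y`. -/
theorem hasDerivAt_integral_of_laplace {s : Set ℝ} (hs : IsOpen s) {g g₁ g₂ h₁ h₂ : ℝ → ℝ → ℂ}
    (hg : ContinuousOn (Function.uncurry g) (s ×ˢ univ))
    (hg₁ : ContinuousOn (Function.uncurry g₁) (s ×ˢ univ))
    (hg₂ : ContinuousOn (Function.uncurry g₂) (s ×ˢ univ))
    (hd₂ : ∀ ρ ∈ s, ∀ ω, HasDerivAt (fun r => g₁ r ω) (g₂ ρ ω) ρ)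
    (hh₁ : ∀ ρ ∈ s, ∀ ω, HasDerivAt (g ρ) (h₁ ρ ω) ω)
    (hh₂ : ∀ ρ ∈ s, ∀ ω, HasDerivAt (h₁ ρ) (h₂ ρ ω) ω)
    (hlap : ∀ ρ ∈ s, ∀ ω, g₂ ρ ω + h₂ ρ ω = 0)
    (hgper : ∀ ρ ∈ s, Function.Periodic (g ρ) (2 * Real.pi))
    (hhper : ∀ ρ ∈ s, Function.Periodic (h₁ ρ) (2 * Real.pi)) {φ φ' : ℝ → ℝ} {k : ℝ}
    (hφ : ∀ ω, HasDerivAt φ (φ' ω) ω) (hφ' : ∀ ω, HasDerivAt φ' (-(k ^ 2 * φ ω)) ω)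
    (hper : Function.Periodic φ (2 * Real.pi)) (hper' : Function.Periodic φ' (2 * Real.pi))
    {ρ : ℝ} (hρ : ρ ∈ s) :
    HasDerivAt (fun r => ∫ ω in (0 : ℝ)..2 * Real.pi, g₁ r ω * φ ω)
      ((k : ℂ) ^ 2 * ∫ ω in (0 : ℝ)..2 * Real.pi, g ρ ω * φ ω) ρ := by
  have hφc : Continuous φ := continuous_iff_continuousAt.2 fun ω => (hφ ω).continuousAt
  have hcφ : ContinuousOn (fun p : ℝ × ℝ => ((φ p.2 : ℝ) : ℂ)) (s ×ˢ univ) :=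
    Continuous.continuousOn (by fun_prop)
  have main := hasDerivAt_intervalIntegral_param hs
    (g := fun r ω => g₁ r ω * φ ω) (g' := fun r ω => g₂ r ω * φ ω)
    (hg₁.mul hcφ) (hg₂.mul hcφ) (fun r hr ω => (hd₂ r hr ω).mul_const _) 0 (2 * Real.pi) hρ
  refine main.congr_deriv ?_
  have hslice : ∀ {h : ℝ → ℝ → ℂ}, ContinuousOn (Function.uncurry h) (s ×ˢ univ) →
      IntervalIntegrable (fun ω => h ρ ω * φ ω) MeasureTheory.volume 0 (2 * Real.pi) :=
    fun {h} hh => ((hh.mul hcφ).comp_continuous (f := fun ω : ℝ => (ρ, ω)) (by fun_prop)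
      fun ω => ⟨hρ, mem_univ _⟩).intervalIntegrable _ _
  have hi1 := hslice hg₂
  have hi2 := hslice hg
  -- Two integrations by parts at once: the integrand is the derivative of the periodic function `h₁
  -- φ - g φ'`.
  have hbd : ∫ ω in (0 : ℝ)..2 * Real.pi,
      ((k : ℂ) ^ 2 * (g ρ ω * φ ω) - g₂ ρ ω * φ ω) = 0 := by
    rw [intervalIntegral.integral_eq_sub_of_hasDerivAt
      (f := fun ω => h₁ ρ ω * φ ω - g ρ ω * φ' ω)]
    · have e1 := hgper ρ hρ 0
      have e2 := hhper ρ hρ 0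
      have e3 := hper 0
      have e4 := hper' 0
      rw [zero_add] at e1 e2 e3 e4
      simp only [e1, e2, e3, e4, sub_self]
    · intro ω _
      refine (((hh₂ ρ hρ ω).mul (hφ ω).ofReal_comp).sub
        ((hh₁ ρ hρ ω).mul (hφ' ω).ofReal_comp)).congr_deriv ?_
      push_cast
      linear_combination (φ ω : ℂ) * hlap ρ hρ ω
    · exact (hi2.const_mul _).sub hi1
  rw [intervalIntegral.integral_sub (hi2.const_mul _) hi1,
    intervalIntegral.integral_const_mul] at hbd
  exact (sub_eq_zero.1 hbd).symm

/-- The trigonometric coefficients of a harmonic function on elliptic annuli satisfy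
`y'' = k² y`. -/
theorem hasDerivAt_integral_fderiv_comp_ell (hs : IsOpen s)
    (hf : ∀ ρ ∈ s, ∀ ω, InnerProductSpace.HarmonicAt f (ell R ρ ω)) {φ φ' : ℝ → ℝ} {k : ℝ}
    (hφ : ∀ ω, HasDerivAt φ (φ' ω) ω) (hφ' : ∀ ω, HasDerivAt φ' (-(k ^ 2 * φ ω)) ω)
    (hper : Function.Periodic φ (2 * Real.pi)) (hper' : Function.Periodic φ' (2 * Real.pi))
    {ρ : ℝ} (hρ : ρ ∈ s) :
    HasDerivAt (fun r => ∫ ω in (0 : ℝ)..2 * Real.pi,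
        fderiv ℝ f (ell R r ω) (ellRho R r ω) * φ ω)
      ((k : ℂ) ^ 2 * ∫ ω in (0 : ℝ)..2 * Real.pi, f (ell R ρ ω) * φ ω) ρ := by
  have hf1 : ∀ ρ ∈ s, ∀ ω, ContDiffAt ℝ 1 (fderiv ℝ f) (ell R ρ ω) := fun ρ hρ ω =>
    (hf ρ hρ ω).1.fderiv_right (by norm_num)
  have hd1 : ∀ ρ ∈ s, ∀ ω, HasFDerivAt f (fderiv ℝ f (ell R ρ ω)) (ell R ρ ω) := fun ρ hρ ω =>
    ((hf ρ hρ ω).1.differentiableAt (by norm_num)).hasFDerivAt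
  have hd2 : ∀ ρ ∈ s, ∀ ω, HasFDerivAt (fderiv ℝ f) (fderiv ℝ (fderiv ℝ f) (ell R ρ ω))
      (ell R ρ ω) := fun ρ hρ ω => ((hf1 ρ hρ ω).differentiableAt (by norm_num)).hasFDerivAt
  have hc1 : ContinuousOn (fun p : ℝ × ℝ => fderiv ℝ f (ell R p.1 p.2)) (s ×ˢ univ) :=
    continuousOn_fderiv_ell fun ρ hρ ω => (hf ρ hρ ω).1.of_le (by norm_num)
  have hc2 : ContinuousOn (fun p : ℝ × ℝ => fderiv ℝ (fderiv ℝ f) (ell R p.1 p.2))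
      (s ×ˢ univ) := fun p hp =>
    (ContinuousAt.comp (g := fderiv ℝ (fderiv ℝ f)) (f := fun p : ℝ × ℝ => ell R p.1 p.2)
      ((hf1 p.1 hp.1 p.2).fderiv_right (m := 0) (by norm_num)).continuousAt
      (continuous_ell R).continuousAt).continuousWithinAt
  have hcR := (continuous_ellRho R).continuousOn (s := s ×ˢ (univ : Set ℝ))
  have hcE := (continuous_ell R).continuousOn (s := s ×ˢ (univ : Set ℝ))
  refine hasDerivAt_integral_of_laplace hs (g := fun r ω => f (ell R r ω))
    (g₁ := fun r ω => fderiv ℝ f (ell R r ω) (ellRho R r ω))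
    (g₂ := fun r ω => fderiv ℝ (fderiv ℝ f) (ell R r ω) (ellRho R r ω) (ellRho R r ω) +
      fderiv ℝ f (ell R r ω) (ell R r ω))
    (h₁ := fun r ω => fderiv ℝ f (ell R r ω) (ellOmega R r ω))
    (h₂ := fun r ω => fderiv ℝ (fderiv ℝ f) (ell R r ω) (ellOmega R r ω) (ellOmega R r ω) +
      fderiv ℝ f (ell R r ω) (-ell R r ω))
    (continuousOn_comp_ell fun ρ hρ ω => (hf ρ hρ ω).1.continuousAt)
    (hc1.clm_apply hcR) (((hc2.clm_apply hcR).clm_apply hcR).add (hc1.clm_apply hcE))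
    ?_ ?_ ?_ ?_ ?_ ?_ hφ hφ' hper hper' hρ
  · intro r hr ω
    have h := (hd2 r hr ω).comp_hasDerivAt r (hasDerivAt_ell_rho R r ω)
    exact h.clm_apply (hasDerivAt_ellRho_rho R r ω)
  · intro r hr ω
    exact (hd1 r hr ω).comp_hasDerivAt ω (hasDerivAt_ell_omega R r ω)
  · intro r hr ω
    have h := (hd2 r hr ω).comp_hasDerivAt ω (hasDerivAt_ell_omega R r ω)
    exact h.clm_apply (hasDerivAt_ellOmega_omega R r ω)
  · intro r hr ω
    -- The first-order terms cancel because the second derivatives of `ell` in `ρ` and in `ω` are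
    -- opposite.
    rw [map_neg]
    linear_combination fderiv_fderiv_ell_add R r ω (hf r hr ω)
  · intro r hr ω
    simp only [ell_add_two_pi]
  · intro r hr ω
    simp only [ell_add_two_pi, ellOmega_add_two_pi]

end HarmonicFunctions

end EllipseResonance

namespace EllipseResonance

/-! ### Trigonometric coefficients of the geometric kernel. -/

section GeometricSeries

open Real in
theorem integral_exp_int_mul_I (m : ℤ) :
    ∫ ω in (0 : ℝ)..2 * π, Complex.exp (m * Complex.I * ω) = if m = 0 then 2 * (π : ℂ) else 0 := by
  split_ifs with h
  · simp [h]
  · have hm : (m : ℂ) * Complex.I ≠ 0 := mul_ne_zero (by exact_mod_cast h) Complex.I_ne_zero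
    rw [integral_exp_mul_complex hm, show (m : ℂ) * Complex.I * ((2 * π : ℝ) : ℂ)
      = m * (2 * π * Complex.I) by push_cast; ring, Complex.exp_int_mul_two_pi_mul_I]
    simp

open Real in
theorem integral_exp_mul_cos (m : ℤ) {n : ℕ} (hn : n ≠ 0) :
    ∫ ω in (0 : ℝ)..2 * π, Complex.exp (m * Complex.I * ω) * (cos (n * ω) : ℝ) =
      if m = n ∨ m = -n then (π : ℂ) else 0 := by
  have h : ∀ ω : ℝ, Complex.exp (m * Complex.I * ω) * ((cos (n * ω) : ℝ) : ℂ) =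
      (Complex.exp ((m + n : ℤ) * Complex.I * ω) + Complex.exp ((m - n : ℤ) * Complex.I * ω))
        * (1 / 2) := fun ω => by
    rw [Complex.ofReal_cos, Complex.cos, mul_div_assoc', mul_add, ← Complex.exp_add,
      ← Complex.exp_add, div_eq_mul_one_div]
    congr 3 <;> (push_cast; ring_nf)
  simp only [h]
  rw [intervalIntegral.integral_mul_const, intervalIntegral.integral_add,
    integral_exp_int_mul_I, integral_exp_int_mul_I]
  · have h1 : m + n = 0 ↔ m = -n := by omega
    have h2 : m - n = 0 ↔ m = n := by omega
    simp only [h1, h2]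
    by_cases c1 : m = n
    · have c2 : m ≠ -n := by omega
      simp only [c1, if_true, true_or]
      rw [if_neg (by omega)]; ring
    · by_cases c2 : m = -n
      · simp only [c2, if_true, or_true]
        rw [if_neg (by omega)]; ring
      · simp [c1, c2]
  · exact Continuous.intervalIntegrable (by fun_prop) _ _
  · exact Continuous.intervalIntegrable (by fun_prop) _ _

open Real in
theorem integral_exp_mul_sin (m : ℤ) {n : ℕ} (hn : n ≠ 0) :
    ∫ ω in (0 : ℝ)..2 * π, Complex.exp (m * Complex.I * ω) * (sin (n * ω) : ℝ) =
      if m = n then Complex.I * π else if m = -n then -(Complex.I * π) else 0 := by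
  have h : ∀ ω : ℝ, Complex.exp (m * Complex.I * ω) * ((sin (n * ω) : ℝ) : ℂ) =
      (Complex.exp ((m - n : ℤ) * Complex.I * ω) - Complex.exp ((m + n : ℤ) * Complex.I * ω))
        * (Complex.I / 2) := fun ω => by
    rw [Complex.ofReal_sin, Complex.sin, ← mul_div_assoc, ← mul_assoc, mul_sub,
      ← Complex.exp_add, ← Complex.exp_add, mul_div_assoc]
    congr 3 <;> (push_cast; ring_nf)
  simp only [h]
  rw [intervalIntegral.integral_mul_const, intervalIntegral.integral_sub,
    integral_exp_int_mul_I, integral_exp_int_mul_I]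
  · have h1 : m + n = 0 ↔ m = -n := by omega
    have h2 : m - n = 0 ↔ m = n := by omega
    simp only [h1, h2]
    by_cases c1 : m = n
    · have c2 : m ≠ -n := by omega
      simp only [c1, if_true]
      rw [if_neg (by omega)]; ring
    · by_cases c2 : m = -n
      · have c3 : (-n : ℤ) ≠ n := by omega
        simp only [c2, if_true, if_neg c3]
        ring
      · simp [c1, c2]
  · exact Continuous.intervalIntegrable (by fun_prop) _ _
  · exact Continuous.intervalIntegrable (by fun_prop) _ _

theorem norm_exp_int_mul_I (m : ℤ) (ω : ℝ) : ‖Complex.exp (m * Complex.I * ω)‖ = 1 := by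
  rw [show (m : ℂ) * Complex.I * ω = ((m * ω : ℝ) : ℂ) * Complex.I by push_cast; ring,
    Complex.norm_exp_ofReal_mul_I]

theorem one_sub_mul_exp_ne_zero {c : ℂ} (hc : ‖c‖ < 1) (m : ℤ) (ω : ℝ) :
    1 - c * Complex.exp (m * Complex.I * ω) ≠ 0 := fun h => by
  have : ‖c * Complex.exp (m * Complex.I * ω)‖ = 1 := by rw [← sub_eq_zero.1 h, norm_one]
  rw [norm_mul, norm_exp_int_mul_I, mul_one] at this
  exact hc.ne this

/-- The geometric series is integrated termwise, dominated by `‖c‖ᵏ ‖ψ‖`. Against `cos nω` or `sin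
nω` only the term `k = n` then survives. -/
theorem hasSum_integral_geometric {c : ℂ} (hc : ‖c‖ < 1) (σ : ℤ) {ψ : ℝ → ℂ} (hψ : Continuous ψ)
    (a b : ℝ) :
    HasSum (fun k : ℕ => c ^ k * ∫ ω in a..b, Complex.exp ((k * σ : ℤ) * Complex.I * ω) * ψ ω)
      (∫ ω in a..b, (1 - c * Complex.exp (σ * Complex.I * ω))⁻¹ * ψ ω) := by
  simp only [← intervalIntegral.integral_const_mul]
  have hgeo := summable_geometric_of_lt_one (norm_nonneg c) hc
  refine intervalIntegral.hasSum_integral_of_dominated_convergence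
    (fun k ω => ‖c‖ ^ k * ‖ψ ω‖) ?_ ?_ ?_ ?_ ?_
  · intro k
    exact Continuous.aestronglyMeasurable (by fun_prop)
  · intro k
    refine .of_forall fun ω _ => ?_
    rw [norm_mul, norm_mul, norm_exp_int_mul_I, norm_pow, one_mul]
  · exact .of_forall fun ω _ => hgeo.mul_right _
  · simp only [tsum_mul_right]
    exact Continuous.intervalIntegrable (by fun_prop) _ _
  · refine .of_forall fun ω _ => ?_
    have h : ‖c * Complex.exp (σ * Complex.I * ω)‖ < 1 := by
      rwa [norm_mul, norm_exp_int_mul_I, mul_one]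
    refine ((hasSum_geometric_of_norm_lt_one h).mul_right (ψ ω)).congr_fun fun k => ?_
    rw [mul_pow, ← Complex.exp_nat_mul, ← mul_assoc]
    congr 3
    push_cast; ring

open Real in
theorem integral_geometric {c : ℂ} (hc : ‖c‖ < 1) {σ : ℤ} (hσ : σ ≠ 0) :
    ∫ ω in (0 : ℝ)..2 * π, (1 - c * Complex.exp (σ * Complex.I * ω))⁻¹ = 2 * π := by
  have h := hasSum_integral_geometric hc σ (ψ := fun _ => 1) continuous_const 0 (2 * π)
  simp only [mul_one] at h
  refine h.unique ?_
  convert! hasSum_single (f := fun k : ℕ => c ^ k *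
    ∫ ω in (0 : ℝ)..2 * π, Complex.exp ((k * σ : ℤ) * Complex.I * ω)) 0 ?_ using 1
  · simp
  · intro k hk
    rw [integral_exp_int_mul_I, if_neg (mul_ne_zero (by exact_mod_cast hk) hσ), mul_zero]

open Real in
theorem integral_geometric_mul_cos {c : ℂ} (hc : ‖c‖ < 1) {σ : ℤ} (hσ : σ = 1 ∨ σ = -1) {n : ℕ}
    (hn : n ≠ 0) :
    ∫ ω in (0 : ℝ)..2 * π, (1 - c * Complex.exp (σ * Complex.I * ω))⁻¹ * (cos (n * ω) : ℝ)
      = π * c ^ n := by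
  have h := hasSum_integral_geometric hc σ (ψ := fun ω => (cos (n * ω) : ℝ)) (by fun_prop)
    0 (2 * π)
  refine h.unique ?_
  convert! hasSum_single (f := fun k : ℕ => c ^ k *
    ∫ ω in (0 : ℝ)..2 * π, Complex.exp ((k * σ : ℤ) * Complex.I * ω) * (cos (n * ω) : ℝ)) n ?_
    using 1
  · rw [integral_exp_mul_cos _ hn, if_pos (by rcases hσ with rfl | rfl <;> simp)]; ring
  · intro k hk
    rw [integral_exp_mul_cos _ hn, if_neg (by rcases hσ with rfl | rfl <;> omega), mul_zero]

open Real in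
theorem integral_geometric_mul_sin {c : ℂ} (hc : ‖c‖ < 1) {σ : ℤ} (hσ : σ = 1 ∨ σ = -1) {n : ℕ}
    (hn : n ≠ 0) :
    ∫ ω in (0 : ℝ)..2 * π, (1 - c * Complex.exp (σ * Complex.I * ω))⁻¹ * (sin (n * ω) : ℝ)
      = σ * Complex.I * π * c ^ n := by
  have h := hasSum_integral_geometric hc σ (ψ := fun ω => (sin (n * ω) : ℝ)) (by fun_prop)
    0 (2 * π)
  refine h.unique ?_
  convert! hasSum_single (f := fun k : ℕ => c ^ k *
    ∫ ω in (0 : ℝ)..2 * π, Complex.exp ((k * σ : ℤ) * Complex.I * ω) * (sin (n * ω) : ℝ)) n ?_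
    using 1
  · rw [integral_exp_mul_sin _ hn]
    rcases hσ with rfl | rfl
    · simp; ring
    · rw [if_neg (by omega), if_pos (by omega)]; push_cast; ring
  · intro k hk
    rw [integral_exp_mul_sin _ hn, if_neg (by rcases hσ with rfl | rfl <;> omega),
      if_neg (by rcases hσ with rfl | rfl <;> omega), mul_zero]

end GeometricSeries

/-! ### The angular and radial modes. -/

section Modes

/-- The angular modes `cos n ω` and `sin n ω`. -/
noncomputable def trig : Bool → ℝ → ℝ
  | true => Real.cos
  | false => Real.sin

/-- The radial modes `cosh` and `sinh`. -/
noncomputable def hyp : Bool → ℝ → ℝ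
  | true => Real.cosh
  | false => Real.sinh

@[fun_prop]
theorem continuous_trig (s : Bool) : Continuous (trig s) := by
  cases s
  exacts [Real.continuous_sin, Real.continuous_cos]

end Modes

/-! ### Expansion of the dipole field in elliptic modes. -/

section Dipole

theorem dipole_eq (a z : Plane) {x : Plane} (hx : x ≠ z) :
    dipole a z x = -((2 * Real.pi)⁻¹ * (inner ℝ (x - z) a / ‖x - z‖ ^ 2)) := by
  have hne : x - z ≠ 0 := sub_ne_zero.2 hx
  have hn : ‖x - z‖ ^ 2 ≠ 0 := by positivity
  have h1 : HasFDerivAt (fun y : Plane => y - z) (ContinuousLinearMap.id ℝ Plane) x :=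
    (hasFDerivAt_id x).sub_const z
  have h2 := ((h1.norm_sq.log hn).const_mul (1 / 2 : ℝ)).const_mul (2 * Real.pi)⁻¹
  -- Writing `ln |x|` as `½ ln |x|²` avoids differentiating the norm.
  have h3 : (fun y : Plane => fundSol (y - z)) =
      fun y => (2 * Real.pi)⁻¹ * ((1 / 2 : ℝ) * Real.log (‖y - z‖ ^ 2)) := by
    funext y
    rw [fundSol, Real.log_pow]; push_cast; ring
  rw [dipole, h3, h2.fderiv]
  simp
  field_simp
  rw [inner_sub_left]

theorem contDiffAt_dipole (a z : Plane) {x : Plane} (hx : x ≠ z) :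
    ContDiffAt ℝ 1 (fun y => (dipole a z y : ℂ)) x := by
  have hne : x - z ≠ 0 := sub_ne_zero.2 hx
  have h : ContDiffAt ℝ 1
      (fun y : Plane => -((2 * Real.pi)⁻¹ * (inner ℝ (y - z) a / ‖y - z‖ ^ 2))) x := by
    refine (contDiffAt_const.mul (ContDiffAt.div ?_ ?_ (by positivity))).neg
    · exact (contDiffAt_id.sub contDiffAt_const).inner ℝ contDiffAt_const
    · exact (contDiffAt_id.sub contDiffAt_const).norm_sq ℝ
  refine (Complex.ofRealCLM.contDiff.contDiffAt.comp x h).congr_of_eventuallyEq ?_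
  filter_upwards [isOpen_ne.mem_nhds hx] with y hy
  rw [dipole_eq a z hy]; rfl

theorem abs_dipole_le (a z : Plane) {x : Plane} (hx : x ≠ z) :
    |dipole a z x| ≤ (2 * Real.pi)⁻¹ * ‖a‖ / ‖x - z‖ := by
  have hne : 0 < ‖x - z‖ := norm_pos_iff.2 (sub_ne_zero.2 hx)
  have hpi := Real.pi_pos
  rw [dipole_eq a z hx, abs_neg, abs_mul, abs_div, abs_of_pos (by positivity : 0 < (2 * Real.pi)⁻¹),
    abs_of_pos (by positivity : 0 < ‖x - z‖ ^ 2), mul_div_assoc]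
  refine mul_le_mul_of_nonneg_left ?_ (by positivity)
  rw [div_le_div_iff₀ (by positivity) hne]
  calc _ ≤ (‖x - z‖ * ‖a‖) * ‖x - z‖ := by gcongr; exact abs_real_inner_le_norm _ _
    _ = _ := by ring

/-- The complex elliptic coordinate expansion of the kernel. -/
theorem sinh_div_cosh_sub_cosh {ζ ξ : ℂ} (h1 : 1 - Complex.exp (-ξ) * Complex.exp ζ ≠ 0)
    (h2 : 1 - Complex.exp (-ξ) * Complex.exp (-ζ) ≠ 0) :
    Complex.cosh ξ - Complex.cosh ζ ≠ 0 ∧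
    Complex.sinh ξ / (Complex.cosh ξ - Complex.cosh ζ) =
      (1 - Complex.exp (-ξ) * Complex.exp ζ)⁻¹ + (1 - Complex.exp (-ξ) * Complex.exp (-ζ))⁻¹
        - 1 := by
  have e1 : Complex.exp ξ = (Complex.exp (-ξ))⁻¹ := by rw [Complex.exp_neg, inv_inv]
  have e2 : Complex.exp (-ζ) = (Complex.exp ζ)⁻¹ := Complex.exp_neg ζ
  have n1 := Complex.exp_ne_zero (-ξ)
  have n2 := Complex.exp_ne_zero ζ
  rw [Complex.cosh, Complex.cosh, Complex.sinh, e1, e2]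
  rw [e2] at h2
  set q := Complex.exp (-ξ)
  set y := Complex.exp ζ
  have key : (q⁻¹ + q) / 2 - (y + y⁻¹) / 2 = (1 - q * y) * (1 - q * y⁻¹) / (2 * q) := by
    field_simp; ring
  refine ⟨?_, ?_⟩
  · rw [key]
    exact div_ne_zero (mul_ne_zero h1 h2) (mul_ne_zero two_ne_zero n1)
  · rw [key]
    field_simp
    have h3 : y - q ≠ 0 := by
      intro h; apply h2; rw [← sub_eq_zero.1 h, mul_inv_cancel₀ n2, sub_self]
    field_simp
    ring

theorem complex_ell (R ρ ω : ℝ) :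
    (⟨ell R ρ ω 0, ell R ρ ω 1⟩ : ℂ) = R * Complex.cosh (ρ + ω * Complex.I) := by
  rw [Complex.cosh_add, Complex.cosh_mul_I, Complex.sinh_mul_I]
  apply Complex.ext <;>
    simp [ell, Complex.cos_ofReal_re, Complex.sin_ofReal_re, Complex.cosh_ofReal_re,
      Complex.sinh_ofReal_re] <;> ring

/-- With `a` and `x` read as complex numbers this is `Re (a x̄) / |x|² = Re (a / x)`; it makes the
dipole the real part of a meromorphic function. -/
theorem inner_div_norm_sq (a x : Plane) :
    inner ℝ x a / ‖x‖ ^ 2 = ((⟨a 0, a 1⟩ : ℂ) / (⟨x 0, x 1⟩ : ℂ)).re := by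
  rw [Complex.div_re, EuclideanSpace.norm_sq_eq, Complex.normSq_mk]
  simp [PiLp.inner_apply, Fin.sum_univ_two]
  ring_nf

theorem ell_ne_of_abs_lt {R : ℝ} (hR : 0 < R) {ρ ω ρ' ω' : ℝ} (h : |ρ| < ρ') :
    ell R ρ ω ≠ ell R ρ' ω' := fun he => by
  have := abs_eq_of_ell_eq hR he
  rw [abs_of_pos ((abs_nonneg ρ).trans_lt h)] at this
  exact h.ne this

/-- With `ζ`, `ξ` the complex elliptic coordinates of the field point and the source, the field is
`Re (a / (2πR (cosh ξ - cosh ζ)))`. By `sinh_div_cosh_sub_cosh` this is a sum of two geometric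
kernels with `q = e^{-ξ}`, after division by `sinh ξ`, which is nonzero as `ρz > 0`. -/
theorem dipole_ell {R : ℝ} (hR : 0 < R) (a : Plane) (ρz ωz : ℝ) (hz : 0 < ρz) :
    ∃ κ q : ℂ, ‖q‖ = Real.exp (-ρz) ∧ ∀ ρ ω : ℝ, |ρ| < ρz →
      ‖q * Real.exp ρ‖ < 1 ∧ ‖q * Real.exp (-ρ)‖ < 1 ∧
      dipole a (ell R ρz ωz) (ell R ρ ω) =
        (κ * ((1 - q * Real.exp ρ * Complex.exp ((1 : ℤ) * Complex.I * ω))⁻¹ +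
          (1 - q * Real.exp (-ρ) * Complex.exp ((-1 : ℤ) * Complex.I * ω))⁻¹ - 1)).re := by
  set ξ : ℂ := ρz + ωz * Complex.I with hξ
  have hq : ‖Complex.exp (-ξ)‖ = Real.exp (-ρz) := by simp [Complex.norm_exp, hξ]
  have hsinh : Complex.sinh ξ ≠ 0 := by
    intro h
    have : Complex.exp ξ = Complex.exp (-ξ) := by
      rw [Complex.sinh] at h
      exact sub_eq_zero.1 ((div_eq_zero_iff.1 h).resolve_right two_ne_zero)
    have := congrArg norm this
    rw [hq, Complex.norm_exp] at this
    have := Real.exp_injective this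
    simp [hξ] at this
    linarith
  refine ⟨(⟨a 0, a 1⟩ : ℂ) / (2 * Real.pi * R * Complex.sinh ξ), Complex.exp (-ξ), hq,
    fun ρ ω hρ => ?_⟩
  have hρ' := abs_lt.1 hρ
  have b1 : ‖Complex.exp (-ξ) * Real.exp ρ‖ < 1 := by
    rw [norm_mul, hq, Complex.norm_real, Real.norm_of_nonneg (Real.exp_pos _).le, ← Real.exp_add,
      Real.exp_lt_one_iff]
    linarith
  have b2 : ‖Complex.exp (-ξ) * Real.exp (-ρ)‖ < 1 := by
    rw [norm_mul, hq, Complex.norm_real, Real.norm_of_nonneg (Real.exp_pos _).le, ← Real.exp_add,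
      Real.exp_lt_one_iff]
    linarith
  refine ⟨b1, b2, ?_⟩
  have c1 := one_sub_mul_exp_ne_zero b1 1 ω
  have c2 := one_sub_mul_exp_ne_zero b2 (-1) ω
  have e1 : Complex.exp (-ξ) * Real.exp ρ * Complex.exp ((1 : ℤ) * Complex.I * ω) =
      Complex.exp (-ξ) * Complex.exp (ρ + ω * Complex.I) := by
    rw [mul_assoc, Complex.ofReal_exp, ← Complex.exp_add]; congr 2; push_cast; ring
  have e2 : Complex.exp (-ξ) * Real.exp (-ρ) * Complex.exp ((-1 : ℤ) * Complex.I * ω) =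
      Complex.exp (-ξ) * Complex.exp (-(ρ + ω * Complex.I)) := by
    rw [mul_assoc, Complex.ofReal_exp, ← Complex.exp_add]; congr 2; push_cast; ring
  rw [e1] at c1 ⊢
  rw [e2] at c2 ⊢
  obtain ⟨hne, hk⟩ := sinh_div_cosh_sub_cosh c1 c2
  rw [← hk, dipole_eq _ _ (ell_ne_of_abs_lt hR hρ), inner_div_norm_sq]
  have hsub : (⟨(ell R ρ ω - ell R ρz ωz) 0, (ell R ρ ω - ell R ρz ωz) 1⟩ : ℂ) =
      R * Complex.cosh (ρ + ω * Complex.I) - R * Complex.cosh ξ := by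
    rw [← complex_ell, ← complex_ell]
    apply Complex.ext <;> simp
  have hRc : (R : ℂ) ≠ 0 := by exact_mod_cast hR.ne'
  have hpi : (Real.pi : ℂ) ≠ 0 := by exact_mod_cast Real.pi_ne_zero
  rw [hsub, ← Complex.re_ofReal_mul, ← Complex.neg_re]
  congr 1
  rw [show R * Complex.cosh (ρ + ω * Complex.I) - R * Complex.cosh ξ =
    -(R * (Complex.cosh ξ - Complex.cosh (ρ + ω * Complex.I))) by ring]
  push_cast
  generalize Complex.cosh ξ - Complex.cosh (ρ + ω * Complex.I) = C at hne
  field_simp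

theorem integral_re_mul {g : ℝ → ℂ} (hg : Continuous g) {φ : ℝ → ℝ} (hφ : Continuous φ)
    (a b : ℝ) : ∫ ω in a..b, ((g ω).re : ℂ) * (φ ω : ℂ) = ((∫ ω in a..b, g ω * φ ω).re : ℝ) := by
  have h := Complex.reCLM.intervalIntegral_comp_comm (μ := MeasureTheory.volume) (a := a) (b := b)
    (f := fun ω => g ω * φ ω) (Continuous.intervalIntegrable (by fun_prop) _ _)
  simp only [Complex.reCLM_apply, Complex.re_mul_ofReal] at h
  rw [← h, ← intervalIntegral.integral_ofReal]
  push_cast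
  rfl

open Real in
/-- The trigonometric coefficients of the dipole field on the ellipses that do not enclose its
source. -/
theorem exists_integral_dipole {R : ℝ} (hR : 0 < R) (a : Plane) (ρz ωz : ℝ) (hz : 0 < ρz) :
    ∃ (C : ℝ) (c₀ : ℂ), 0 ≤ C ∧
      (∀ ρ, |ρ| < ρz →
        ∫ ω in (0 : ℝ)..2 * π, (dipole a (ell R ρz ωz) (ell R ρ ω) : ℂ) = c₀) ∧
      ∀ (s : Bool) (n : ℕ), n ≠ 0 → ∃ f : ℂ, ‖f‖ ≤ C * exp (-(n * ρz)) ∧ ∀ ρ, |ρ| < ρz →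
        ∫ ω in (0 : ℝ)..2 * π, (dipole a (ell R ρz ωz) (ell R ρ ω) : ℂ) * trig s (n * ω)
          = f * hyp s (n * ρ) := by
  obtain ⟨κ, q, hq, H⟩ := dipole_ell hR a ρz ωz hz
  refine ⟨2 * π * ‖κ‖, ((κ * (2 * π)).re : ℝ), by positivity, fun ρ hρ => ?_, fun s n hn => ?_⟩
  · obtain ⟨b1, b2, -⟩ := H ρ 0 hρ
    have i1 := fun ω => one_sub_mul_exp_ne_zero b1 1 ω
    have i2 := fun ω => one_sub_mul_exp_ne_zero b2 (-1) ω
    have c1 : Continuous fun ω : ℝ =>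
        (1 - q * Real.exp ρ * Complex.exp ((1 : ℤ) * Complex.I * ω))⁻¹ :=
      Continuous.inv₀ (by fun_prop) i1
    have c2 : Continuous fun ω : ℝ =>
        (1 - q * Real.exp (-ρ) * Complex.exp ((-1 : ℤ) * Complex.I * ω))⁻¹ :=
      Continuous.inv₀ (by fun_prop) i2
    have h := integral_re_mul (g := fun ω : ℝ => κ *
      ((1 - q * Real.exp ρ * Complex.exp ((1 : ℤ) * Complex.I * ω))⁻¹ +
        (1 - q * Real.exp (-ρ) * Complex.exp ((-1 : ℤ) * Complex.I * ω))⁻¹ - 1))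
      (continuous_const.mul ((c1.add c2).sub continuous_const)) (continuous_const (y := (1 : ℝ))) 0 (2 * π)
    simp only [Complex.ofReal_one, mul_one] at h
    simp only [fun ω => (H ρ ω hρ).2.2]
    rw [h, intervalIntegral.integral_const_mul, intervalIntegral.integral_sub,
      intervalIntegral.integral_add, integral_geometric b1 one_ne_zero,
      integral_geometric b2 (by norm_num)]
    · simp
    · exact c1.intervalIntegrable _ _
    · exact c2.intervalIntegrable _ _
    · exact (c1.add c2).intervalIntegrable _ _
    · exact intervalIntegrable_const
  -- The kernels with `σ = 1` and `σ = -1` contribute `e^{nρ}` and `e^{-nρ}`: added for cosines,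
  -- giving `2 cosh nρ`, and subtracted with a factor `i` for sines, giving `2i sinh nρ`.
  · refine ⟨((κ * (2 * π * (if s then 1 else Complex.I) * q ^ n)).re : ℝ), ?_, fun ρ hρ => ?_⟩
    · rw [Complex.norm_real]
      refine (Complex.abs_re_le_norm _).trans ?_
      have : ‖(if s then 1 else Complex.I : ℂ)‖ = 1 := by cases s <;> simp
      rw [norm_mul, norm_mul, norm_mul, this, norm_pow, hq, ← Real.exp_nat_mul]
      simp only [norm_mul, Complex.norm_real, Real.norm_of_nonneg pi_pos.le, Complex.norm_ofNat]
      rw [mul_neg]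
      apply le_of_eq; ring
    obtain ⟨b1, b2, -⟩ := H ρ 0 hρ
    have i1 := fun ω => one_sub_mul_exp_ne_zero b1 1 ω
    have i2 := fun ω => one_sub_mul_exp_ne_zero b2 (-1) ω
    have c1 : Continuous fun ω : ℝ =>
        (1 - q * Real.exp ρ * Complex.exp ((1 : ℤ) * Complex.I * ω))⁻¹ :=
      Continuous.inv₀ (by fun_prop) i1
    have c2 : Continuous fun ω : ℝ =>
        (1 - q * Real.exp (-ρ) * Complex.exp ((-1 : ℤ) * Complex.I * ω))⁻¹ :=
      Continuous.inv₀ (by fun_prop) i2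
    have c3 : Continuous fun ω : ℝ => trig s (n * ω) := by
      exact (continuous_trig s).comp (by fun_prop)
    have c4 : Continuous fun ω : ℝ => (trig s (n * ω) : ℂ) := by fun_prop
    have h := integral_re_mul (g := fun ω : ℝ => κ *
      ((1 - q * Real.exp ρ * Complex.exp ((1 : ℤ) * Complex.I * ω))⁻¹ +
        (1 - q * Real.exp (-ρ) * Complex.exp ((-1 : ℤ) * Complex.I * ω))⁻¹ - 1))
      (continuous_const.mul ((c1.add c2).sub continuous_const)) c3 0 (2 * π)
    simp only [fun ω => (H ρ ω hρ).2.2]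
    rw [h]
    simp only [mul_assoc κ, sub_mul, add_mul, one_mul]
    have hn' : (0 : ℤ) ≠ n := by omega
    have h0 : ∫ ω in (0 : ℝ)..2 * π, (trig s (n * ω) : ℂ) = 0 := by
      cases s
      · simpa [trig, hn', hn] using integral_exp_mul_sin 0 hn
      · simpa [trig, hn', hn] using integral_exp_mul_cos 0 hn
    rw [intervalIntegral.integral_const_mul, intervalIntegral.integral_sub,
      intervalIntegral.integral_add, h0, sub_zero, ← Complex.ofReal_mul, ← Complex.re_mul_ofReal]
    · congr 2
      rw [mul_assoc κ]
      congr 1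
      have ep : ((Real.exp ρ : ℝ) : ℂ) ^ n = Complex.exp (n * ρ) := by
        rw [Complex.ofReal_exp, ← Complex.exp_nat_mul]
      have em : ((Real.exp (-ρ) : ℝ) : ℂ) ^ n = Complex.exp (-(n * ρ)) := by
        rw [Complex.ofReal_exp, ← Complex.exp_nat_mul]; congr 1; push_cast; ring
      cases s
      · simp only [trig, hyp]
        rw [integral_geometric_mul_sin b1 (Or.inl rfl) hn,
          integral_geometric_mul_sin b2 (Or.inr rfl) hn, mul_pow, mul_pow, ep, em,
          Complex.ofReal_sinh, Complex.sinh]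
        push_cast; ring
      · simp only [trig, hyp]
        rw [integral_geometric_mul_cos b1 (Or.inl rfl) hn,
          integral_geometric_mul_cos b2 (Or.inr rfl) hn, mul_pow, mul_pow, ep, em,
          Complex.ofReal_cosh, Complex.cosh]
        push_cast; ring
    · exact (c1.mul c4).intervalIntegrable _ _
    · exact (c2.mul c4).intervalIntegrable _ _
    · exact ((c1.mul c4).add (c2.mul c4)).intervalIntegrable _ _
    · exact c4.intervalIntegrable _ _

end Dipole

end EllipseResonance

namespace EllipseResonance

/-! ### Calculus, monotonicity and parity of the modes. -/

section Modes

theorem hasDerivAt_hyp (s : Bool) (x : ℝ) : HasDerivAt (hyp s) (hyp (!s) x) x := by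
  cases s
  exacts [Real.hasDerivAt_sinh x, Real.hasDerivAt_cosh x]

theorem continuous_hyp (s : Bool) : Continuous (hyp s) :=
  continuous_iff_continuousAt.2 fun x => (hasDerivAt_hyp s x).continuousAt

theorem hyp_nonneg (s : Bool) {x : ℝ} (hx : 0 ≤ x) : 0 ≤ hyp s x := by
  cases s
  exacts [Real.sinh_nonneg_iff.2 hx, (Real.cosh_pos x).le]

theorem hyp_mono (s : Bool) {x y : ℝ} (hx : 0 ≤ x) (hxy : x ≤ y) : hyp s x ≤ hyp s y := by
  cases s
  · exact Real.sinh_le_sinh.2 hxy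
  · exact Real.cosh_le_cosh.2 (by rwa [abs_of_nonneg hx, abs_of_nonneg (hx.trans hxy)])

theorem hasDerivAt_trig_nat_mul (s : Bool) (n : ℕ) (ω : ℝ) :
    HasDerivAt (fun t => trig s (n * t))
      ((if s then -(n : ℝ) else n) * trig (!s) (n * ω)) ω := by
  have h := (hasDerivAt_id ω).const_mul (n : ℝ)
  cases s
  · exact h.sin.congr_deriv (by simp [trig]; ring)
  · exact h.cos.congr_deriv (by simp [trig]; ring)

theorem periodic_trig_nat_mul (s : Bool) (n : ℕ) :
    Function.Periodic (fun t => trig s (n * t)) (2 * Real.pi) := fun t => by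
  cases s
  · simp only [trig, mul_add]; exact Real.sin_add_nat_mul_two_pi _ _
  · simp only [trig, mul_add]; exact Real.cos_add_nat_mul_two_pi _ _

theorem continuous_trig_nat_mul (s : Bool) (n : ℕ) : Continuous fun t : ℝ => trig s (n * t) :=
  (continuous_trig s).comp (by fun_prop)

theorem abs_trig_le_one (s : Bool) (x : ℝ) : |trig s x| ≤ 1 := by
  cases s
  exacts [Real.abs_sin_le_one x, Real.abs_cos_le_one x]

theorem integral_comp_neg_of_periodic {g : ℝ → ℂ} (hg : Function.Periodic g (2 * Real.pi)) :
    ∫ ω in (0 : ℝ)..2 * Real.pi, g (-ω) = ∫ ω in (0 : ℝ)..2 * Real.pi, g ω := by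
  rw [intervalIntegral.integral_comp_neg, neg_zero]
  simpa using hg.intervalIntegral_add_eq (-(2 * Real.pi)) 0

theorem trig_neg (s : Bool) (x : ℝ) : trig s (-x) = (if s then 1 else -1) * trig s x := by
  cases s <;> simp [trig]

end Modes

/-! ### Radial form of the coefficients inside and outside the ellipse. -/

section Coefficients

variable {R ρ₀ : ℝ}

/-- The trigonometric coefficient of `f` on the ellipse of elliptic radius `ρ`. -/
noncomputable def coeff (R : ℝ) (f : Plane → ℂ) (s : Bool) (n : ℕ) (ρ : ℝ) : ℂ :=
  ∫ ω in (0 : ℝ)..2 * Real.pi, f (ell R ρ ω) * trig s (n * ω)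

/-- The trigonometric coefficient of the derivative of `f` in the elliptic radius. -/
noncomputable def coeffDeriv (R : ℝ) (f : Plane → ℂ) (s : Bool) (n : ℕ) (ρ : ℝ) : ℂ :=
  ∫ ω in (0 : ℝ)..2 * Real.pi, fderiv ℝ f (ell R ρ ω) (ellRho R ρ ω) * trig s (n * ω)

theorem hasDerivAt_coeff {f : Plane → ℂ} {I : Set ℝ} (hI : IsOpen I)
    (hf : ∀ ρ ∈ I, ∀ ω, ContDiffAt ℝ 1 f (ell R ρ ω)) (s : Bool) (n : ℕ) {ρ : ℝ} (hρ : ρ ∈ I) :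
    HasDerivAt (coeff R f s n) (coeffDeriv R f s n ρ) ρ :=
  hasDerivAt_integral_comp_ell hI hf (continuous_trig_nat_mul s n) _ _ hρ

theorem hasDerivAt_coeffDeriv {f : Plane → ℂ} {I : Set ℝ} (hI : IsOpen I)
    (hf : ∀ ρ ∈ I, ∀ ω, InnerProductSpace.HarmonicAt f (ell R ρ ω)) (s : Bool) (n : ℕ) {ρ : ℝ}
    (hρ : ρ ∈ I) :
    HasDerivAt (coeffDeriv R f s n) (((n : ℝ) : ℂ) ^ 2 * coeff R f s n ρ) ρ := by
  refine hasDerivAt_integral_fderiv_comp_ell hI hf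
    (φ := fun ω => trig s (n * ω))
    (φ' := fun ω => (if s then -(n : ℝ) else n) * trig (!s) (n * ω))
    (hasDerivAt_trig_nat_mul s n) (fun ω => ?_) (periodic_trig_nat_mul s n) ?_ hρ
  · refine ((hasDerivAt_trig_nat_mul (!s) n ω).const_mul _).congr_deriv ?_
    cases s <;> simp <;> ring
  · intro ω
    simp only [periodic_trig_nat_mul (!s) n ω]

/-- Since `(-ρ, -ω)` and `(ρ, ω)` name the same point, the coefficient inherits the parity of the
angular mode. This encodes smoothness across the segment between the foci. -/
theorem coeff_neg (f : Plane → ℂ) (s : Bool) (n : ℕ) (ρ : ℝ) :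
    coeff R f s n (-ρ) = (if s then 1 else -1) * coeff R f s n ρ := by
  have hper : Function.Periodic (fun ω => f (ell R (-ρ) ω) * (trig s (n * ω) : ℂ))
      (2 * Real.pi) := fun ω => by
    simp only [ell_add_two_pi, periodic_trig_nat_mul s n ω]
  rw [coeff, ← integral_comp_neg_of_periodic hper, coeff, ← intervalIntegral.integral_const_mul]
  refine intervalIntegral.integral_congr fun ω _ => ?_
  simp only [ell_neg_neg, mul_neg, trig_neg]
  cases s <;> simp

theorem continuousOn_coeff {f : Plane → ℂ} {I : Set ℝ}
    (hf : ∀ ρ ∈ I, ∀ ω, ContinuousAt f (ell R ρ ω)) (s : Bool) (n : ℕ) :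
    ContinuousOn (coeff R f s n) I := by
  refine continuousOn_intervalIntegral_param
    (g := fun ρ ω => f (ell R ρ ω) * (trig s (n * ω) : ℂ)) ?_ _ _
  exact (continuousOn_comp_ell hf).mul (Continuous.continuousOn (by fun_prop))

theorem exists_coeff_eq_hyp {u : Plane → ℂ}
    (hu : InnerProductSpace.HarmonicOnNhd u (inside R ρ₀)) (s : Bool) {n : ℕ} (hn : n ≠ 0) :
    ∃ P : ℂ, ∀ ρ, |ρ| < ρ₀ → coeff R u s n ρ = P * hyp s (n * ρ) := by
  have hmem : ∀ {ρ}, ρ ∈ Ioo (-ρ₀) ρ₀ ↔ |ρ| < ρ₀ := by intro ρ; rw [abs_lt]; rfl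
  have hh : ∀ ρ ∈ Ioo (-ρ₀) ρ₀, ∀ ω, InnerProductSpace.HarmonicAt u (ell R ρ ω) :=
    fun ρ hρ ω => hu _ (ell_mem_inside (hmem.1 hρ) ω)
  obtain ⟨A, B, hAB⟩ := exists_exp_of_hasDerivAt isOpen_Ioo isPreconnected_Ioo
    (k := n) (by exact_mod_cast hn)
    (fun ρ hρ => hasDerivAt_coeff isOpen_Ioo
      (fun ρ hρ ω => (hh ρ hρ ω).1.of_le (by norm_num)) s n hρ)
    (fun ρ hρ => hasDerivAt_coeffDeriv isOpen_Ioo hh s n hρ)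
  -- The even part of `A e^{nρ} + B e^{-nρ}` is `(A + B) cosh nρ`, the odd part `(A - B) sinh nρ`.
  refine ⟨if s then A + B else A - B, fun ρ hρ => ?_⟩
  have h1 := hAB ρ (hmem.2 hρ)
  have h2 := hAB (-ρ) (hmem.2 (by rwa [abs_neg]))
  rw [coeff_neg, mul_neg, neg_neg] at h2
  cases s
  · simp only [Bool.false_eq_true, if_false, hyp, Real.sinh_eq] at h2 ⊢
    push_cast at h1 h2 ⊢
    linear_combination (1 / 2) * h1 - (1 / 2) * h2
  · simp only [if_true, hyp, Real.cosh_eq] at h2 ⊢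
    push_cast at h1 h2 ⊢
    linear_combination (1 / 2) * h1 + (1 / 2) * h2

theorem exists_coeff_zero_eq {u : Plane → ℂ}
    (hu : InnerProductSpace.HarmonicOnNhd u (inside R ρ₀)) :
    ∃ A : ℂ, ∀ ρ, |ρ| < ρ₀ → coeff R u true 0 ρ = A := by
  have hmem : ∀ {ρ}, ρ ∈ Ioo (-ρ₀) ρ₀ ↔ |ρ| < ρ₀ := by intro ρ; rw [abs_lt]; rfl
  have hh : ∀ ρ ∈ Ioo (-ρ₀) ρ₀, ∀ ω, InnerProductSpace.HarmonicAt u (ell R ρ ω) :=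
    fun ρ hρ ω => hu _ (ell_mem_inside (hmem.1 hρ) ω)
  obtain ⟨A, B, hAB⟩ := exists_affine_of_hasDerivAt isOpen_Ioo isPreconnected_Ioo
    (fun ρ hρ => hasDerivAt_coeff isOpen_Ioo
      (fun ρ hρ ω => (hh ρ hρ ω).1.of_le (by norm_num)) true 0 hρ)
    (fun ρ hρ => (hasDerivAt_coeffDeriv isOpen_Ioo hh true 0 hρ).congr_deriv (by simp))
  refine ⟨A, fun ρ hρ => ?_⟩
  have h1 := hAB ρ (hmem.2 hρ)
  have h2 := hAB (-ρ) (hmem.2 (by rwa [abs_neg]))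
  rw [coeff_neg] at h2
  simp only [if_true] at h2
  push_cast at h1 h2
  linear_combination (1 / 2) * h1 + (1 / 2) * h2

theorem tendsto_coeff_zero {w : Plane → ℂ}
    (hw : ∀ ε > 0, ∀ᶠ ρ in atTop, ∀ ω, ‖w (ell R ρ ω)‖ ≤ ε) (s : Bool) (n : ℕ) :
    Tendsto (coeff R w s n) atTop (𝓝 0) := by
  have hpi := Real.pi_pos
  rw [Metric.tendsto_nhds]
  intro ε hε
  filter_upwards [hw (ε / (4 * Real.pi)) (by positivity)] with ρ hρ
  rw [dist_zero_right]
  refine (intervalIntegral.norm_integral_le_of_norm_le_const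
    (C := ε / (4 * Real.pi)) fun ω _ => ?_).trans_lt ?_
  · rw [norm_mul, Complex.norm_real]
    exact (mul_le_of_le_one_right (norm_nonneg _) (abs_trig_le_one _ _)).trans (hρ ω)
  · rw [sub_zero, abs_of_pos (by positivity)]
    have : ε / (4 * Real.pi) * (2 * Real.pi) = ε / 2 := by field_simp; norm_num
    linarith

theorem exists_coeff_eq_exp_neg {w : Plane → ℂ}
    (hw : InnerProductSpace.HarmonicOnNhd w (outside R ρ₀))
    (hdecay : ∀ ε > 0, ∀ᶠ ρ in atTop, ∀ ω, ‖w (ell R ρ ω)‖ ≤ ε) (s : Bool) {n : ℕ}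
    (hn : n ≠ 0) :
    ∃ b : ℂ, ∀ ρ, ρ₀ < ρ → coeff R w s n ρ = b * Real.exp (-(n * (ρ - ρ₀))) := by
  have hh : ∀ ρ ∈ Ioi ρ₀, ∀ ω, InnerProductSpace.HarmonicAt w (ell R ρ ω) :=
    fun ρ hρ ω => hw _ (ell_mem_outside hρ ω)
  obtain ⟨A, B, hAB⟩ := exists_exp_of_hasDerivAt isOpen_Ioi isPreconnected_Ioi
    (k := n) (by exact_mod_cast hn)
    (fun ρ hρ => hasDerivAt_coeff isOpen_Ioi
      (fun ρ hρ ω => (hh ρ hρ ω).1.of_le (by norm_num)) s n hρ)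
    (fun ρ hρ => hasDerivAt_coeffDeriv isOpen_Ioi hh s n hρ)
  have hnpos : (0 : ℝ) < n := by exact_mod_cast Nat.pos_of_ne_zero hn
  have hlin : Tendsto (fun ρ : ℝ => (n : ℝ) * ρ) atTop atTop := tendsto_id.const_mul_atTop hnpos
  have hexp : Tendsto (fun ρ : ℝ => ((Real.exp (-(n * ρ)) : ℝ) : ℂ)) atTop (𝓝 0) := by
    have := (Real.tendsto_exp_neg_atTop_nhds_zero.comp hlin).ofReal
    rwa [Complex.ofReal_zero] at this
  -- Multiplying by `e^{-nρ}` and letting `ρ → ∞` isolates the coefficient of the growing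
  -- exponential.
  have hA : A = 0 := by
    have h1 : Tendsto (fun ρ => coeff R w s n ρ * ((Real.exp (-(n * ρ)) : ℝ) : ℂ)) atTop
        (𝓝 (0 * 0)) := (tendsto_coeff_zero hdecay s n).mul hexp
    have h2 : Tendsto (fun ρ : ℝ => A + B * ((Real.exp (-(n * ρ)) : ℝ) : ℂ) *
        ((Real.exp (-(n * ρ)) : ℝ) : ℂ)) atTop (𝓝 (A + B * 0 * 0)) :=
      ((hexp.const_mul B).mul hexp).const_add A
    have h3 : (fun ρ => coeff R w s n ρ * ((Real.exp (-(n * ρ)) : ℝ) : ℂ)) =ᶠ[atTop]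
        fun ρ : ℝ => A + B * ((Real.exp (-(n * ρ)) : ℝ) : ℂ) *
          ((Real.exp (-(n * ρ)) : ℝ) : ℂ) := by
      filter_upwards [eventually_gt_atTop ρ₀] with ρ hρ
      have : ((Real.exp (n * ρ) : ℝ) : ℂ) * Real.exp (-(n * ρ)) = 1 := by
        rw [← Complex.ofReal_mul, ← Real.exp_add]; simp
      rw [hAB ρ hρ]
      linear_combination A * this
    have := tendsto_nhds_unique (h1.congr' h3) h2
    simpa using this.symm
  refine ⟨B * Real.exp (-(n * ρ₀)), fun ρ hρ => ?_⟩
  rw [hAB ρ hρ, hA, zero_mul, zero_add, mul_assoc, ← Complex.ofReal_mul, ← Real.exp_add]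
  congr 3; ring

/-- The mean is affine in `ρ` and tends to `0`; its increment over a unit step kills the slope, its
limit the constant. -/
theorem coeff_zero_eq_zero {w : Plane → ℂ}
    (hw : InnerProductSpace.HarmonicOnNhd w (outside R ρ₀))
    (hdecay : ∀ ε > 0, ∀ᶠ ρ in atTop, ∀ ω, ‖w (ell R ρ ω)‖ ≤ ε) {ρ : ℝ} (hρ : ρ₀ < ρ) :
    coeff R w true 0 ρ = 0 := by
  have hh : ∀ ρ ∈ Ioi ρ₀, ∀ ω, InnerProductSpace.HarmonicAt w (ell R ρ ω) :=
    fun ρ hρ ω => hw _ (ell_mem_outside hρ ω)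
  obtain ⟨A, B, hAB⟩ := exists_affine_of_hasDerivAt isOpen_Ioi isPreconnected_Ioi
    (fun ρ hρ => hasDerivAt_coeff isOpen_Ioi
      (fun ρ hρ ω => (hh ρ hρ ω).1.of_le (by norm_num)) true 0 hρ)
    (fun ρ hρ => (hasDerivAt_coeffDeriv isOpen_Ioi hh true 0 hρ).congr_deriv (by simp))
  have ht := tendsto_coeff_zero hdecay true 0
  have hB : B = 0 := by
    have h1 : Tendsto (fun ρ => coeff R w true 0 (ρ + 1) - coeff R w true 0 ρ) atTop
        (𝓝 (0 - 0)) := (ht.comp (tendsto_atTop_add_const_right _ 1 tendsto_id)).sub ht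
    have h3 : (fun ρ => coeff R w true 0 (ρ + 1) - coeff R w true 0 ρ) =ᶠ[atTop]
        fun _ => B := by
      filter_upwards [eventually_gt_atTop ρ₀] with ρ hρ
      rw [hAB ρ hρ, hAB (ρ + 1) (lt_trans (show ρ₀ < ρ from hρ) (lt_add_one ρ))]
      push_cast; ring
    have := tendsto_nhds_unique (h1.congr' h3) tendsto_const_nhds
    simpa using this.symm
  have hA : A = 0 := by
    have h3 : coeff R w true 0 =ᶠ[atTop] fun _ => A := by
      filter_upwards [eventually_gt_atTop ρ₀] with ρ hρ
      rw [hAB ρ hρ, hB]; simp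
    exact (tendsto_nhds_unique (ht.congr' h3) tendsto_const_nhds).symm
  rw [hAB ρ hρ, hA, hB]; simp

theorem tendsto_coeffDeriv_boundary {u : Plane → ℂ} {S : Set Plane} {I : Set ℝ} {e : ℝ}
    (he : e ∈ closure I) (hS : ∀ ρ ∈ I, ∀ ω, ell R ρ ω ∈ S)
    (hu : ∀ ρ ∈ I, ∀ ω, ContDiffAt ℝ 1 u (ell R ρ ω)) {D : ℝ → Plane →L[ℝ] ℂ}
    (hD : ∀ ω, Tendsto (fderiv ℝ u) (𝓝[S] (ell R e ω)) (𝓝 (D ω))) (s : Bool) (n : ℕ) :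
    Tendsto (coeffDeriv R u s n) (𝓝[I] e)
      (𝓝 (∫ ω in (0 : ℝ)..2 * Real.pi, D ω (ellRho R e ω) * trig s (n * ω))) := by
  have hφ' : Continuous fun p : ℝ × ℝ => ((trig s (n * p.2) : ℝ) : ℂ) := by fun_prop
  refine tendsto_intervalIntegral_boundary he
    (g := fun ρ ω => fderiv ℝ u (ell R ρ ω) (ellRho R ρ ω) * (trig s (n * ω) : ℂ)) ?_ ?_ _ _
  · exact ((continuousOn_fderiv_ell hu).clm_apply (continuous_ellRho R).continuousOn).mul
      hφ'.continuousOn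
  · intro ω
    have h1 : Tendsto (fun p : ℝ × ℝ => ell R p.1 p.2) (𝓝[I ×ˢ univ] (e, ω))
        (𝓝[S] (ell R e ω)) := by
      refine tendsto_nhdsWithin_iff.2 ⟨?_, ?_⟩
      · exact ((continuous_ell R).tendsto (e, ω)).mono_left nhdsWithin_le_nhds
      · filter_upwards [self_mem_nhdsWithin] with p hp
        exact hS p.1 hp.1 p.2
    have h2 := ((continuous_ellRho R).tendsto (e, ω)).mono_left
      (nhdsWithin_le_nhds (s := I ×ˢ univ))
    have h3 := (hφ'.tendsto (e, ω)).mono_left (nhdsWithin_le_nhds (s := I ×ˢ univ))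
    have h4 : Tendsto (fun p : ℝ × ℝ => fderiv ℝ u (ell R p.1 p.2)) (𝓝[I ×ˢ univ] (e, ω))
        (𝓝 (D ω)) := (hD ω).comp h1
    exact ((isBoundedBilinearMap_apply.continuous.tendsto (D ω, ellRho R e ω)).comp
      (h4.prodMk_nhds h2)).mul h3

end Coefficients

end EllipseResonance

namespace EllipseResonance

/-! ### Transmission conditions, mode by mode. -/

section Transmission

/-- The resonance denominator, bounded below uniformly in `δ`. For `ε_in = -ε_m + iδ` it equals `2σ
ε_m t + iδ (1 - σt)`: the real part controls `2ε_m t`, and the imaginary part controls `δt` because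
`t ≤ e^{-2ρ₀} < 1`. For `λ = iδ` it factors as `(ε_m - ε_in)(σt - 2iδ)`, and the real part of the
second factor has modulus `t`. -/
theorem norm_sub_mul_le_of_permittivity {ρ₀ εm : ℝ} (hρ₀ : 0 < ρ₀) (hεm : 0 < εm) {εin : ℝ → ℂ}
    (hεin : (∀ δ : ℝ, 0 < δ → εin δ = -(εm : ℂ) + Complex.I * (δ : ℂ)) ∨
      (∀ δ : ℝ, 0 < δ →
        (εin δ + (εm : ℂ)) / (2 * (εin δ - (εm : ℂ))) = Complex.I * (δ : ℂ))) :
    ∃ K : ℝ, 0 < K ∧ ∀ δ : ℝ, 0 < δ → εin δ ≠ εm ∧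
      ∀ t : ℝ, 0 < t → t ≤ Real.exp (-(2 * ρ₀)) → ∀ σ : ℝ, (σ = 1 ∨ σ = -1) →
        ‖(εm : ℂ) - εin δ‖ * t ≤ K * ‖(εin δ + εm) + σ * (εm - εin δ) * t‖ := by
  have he : Real.exp (-(2 * ρ₀)) < 1 := Real.exp_lt_one_iff.2 (by linarith)
  have hd : 0 < 1 - Real.exp (-(2 * ρ₀)) := by linarith
  refine ⟨1 + 1 / (1 - Real.exp (-(2 * ρ₀))), by positivity, fun δ hδ => ?_⟩
  rcases hεin with h | h
  · have h := h δ hδ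
    refine ⟨fun hc => ?_, fun t ht ht' σ hσ => ?_⟩
    · have := congrArg Complex.im (h.symm.trans hc)
      simp at this
      linarith
    · set N := ‖(εin δ + εm) + σ * (εm - εin δ) * t‖
      have hσ2 : σ * σ = 1 := by rcases hσ with rfl | rfl <;> norm_num
      have hre : 2 * εm * t ≤ N := by
        have := Complex.abs_re_le_norm ((εin δ + εm) + σ * (εm - εin δ) * t)
        have e : ((εin δ + εm) + σ * (εm - εin δ) * t).re = σ * (2 * εm * t) := by
          rw [h]; simp; ring
        have hσa : |σ| = 1 := by rcases hσ with rfl | rfl <;> norm_num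
        rwa [e, abs_mul, hσa, one_mul, abs_of_pos (by positivity)] at this
      have him : δ * (1 - Real.exp (-(2 * ρ₀))) ≤ N := by
        have := Complex.abs_im_le_norm ((εin δ + εm) + σ * (εm - εin δ) * t)
        have e : ((εin δ + εm) + σ * (εm - εin δ) * t).im = δ * (1 - σ * t) := by
          rw [h]; simp; ring
        rw [e] at this
        refine le_trans ?_ ((le_abs_self _).trans this)
        gcongr
        rcases hσ with rfl | rfl <;> linarith
      have hnorm : ‖(εm : ℂ) - εin δ‖ ≤ 2 * εm + δ := by
        rw [h, show (εm : ℂ) - (-(εm : ℂ) + Complex.I * δ) = ((2 * εm : ℝ) : ℂ) - Complex.I * δ by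
          push_cast; ring]
        refine (norm_sub_le _ _).trans ?_
        rw [norm_mul, Complex.norm_I, one_mul, Complex.norm_real, Complex.norm_real,
          Real.norm_of_nonneg (by positivity), Real.norm_of_nonneg hδ.le]
      have hδt : δ * t ≤ N / (1 - Real.exp (-(2 * ρ₀))) := by
        rw [le_div_iff₀ hd]
        refine le_trans ?_ him
        have : t ≤ 1 := ht'.trans he.le
        nlinarith [mul_pos hδ hd]
      calc ‖(εm : ℂ) - εin δ‖ * t ≤ (2 * εm + δ) * t := by gcongr
        _ = 2 * εm * t + δ * t := by ring
        _ ≤ N + N / (1 - Real.exp (-(2 * ρ₀))) := add_le_add hre hδt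
        _ = _ := by ring
  · have h := h δ hδ
    -- Division by zero yields `0`, whereas the quotient is `iδ ≠ 0`.
    have hne : εin δ - εm ≠ 0 := fun hc => by
      rw [hc, mul_zero, div_zero] at h
      exact mul_ne_zero Complex.I_ne_zero (by exact_mod_cast hδ.ne') h.symm
    refine ⟨sub_ne_zero.1 hne, fun t ht ht' σ hσ => ?_⟩
    have h2 : εin δ + εm = Complex.I * δ * (2 * (εin δ - εm)) := by
      rw [← h]; field_simp
    have e : (εin δ + εm) + σ * (εm - εin δ) * t
        = (εm - εin δ) * (((σ * t : ℝ) : ℂ) - 2 * Complex.I * δ) := by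
      rw [h2]; push_cast; ring
    have hσa : |σ| = 1 := by rcases hσ with rfl | rfl <;> norm_num
    have ht2 : t ≤ ‖((σ * t : ℝ) : ℂ) - 2 * Complex.I * δ‖ := by
      have := Complex.abs_re_le_norm (((σ * t : ℝ) : ℂ) - 2 * Complex.I * δ)
      have e : (((σ * t : ℝ) : ℂ) - 2 * Complex.I * δ).re = σ * t := by simp
      rwa [e, abs_mul, hσa, one_mul, abs_of_pos ht] at this
    rw [e, norm_mul]
    refine le_trans (by gcongr) (le_mul_of_one_le_left (by positivity) ?_)
    have : 0 < 1 / (1 - Real.exp (-(2 * ρ₀))) := by positivity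
    linarith

/-- The transmission conditions for a single mode determine the reflected amplitude `b`, and bound
it in terms of the incident amplitude `f`. -/
theorem norm_reflected_le {ρ₀ : ℝ} (hρ₀ : 0 < ρ₀) {εm : ℝ} {ε : ℂ} {K : ℝ} (hne : ε ≠ εm)
    (hK : ∀ t : ℝ, 0 < t → t ≤ Real.exp (-(2 * ρ₀)) → ∀ σ : ℝ, (σ = 1 ∨ σ = -1) →
        ‖(εm : ℂ) - ε‖ * t ≤ K * ‖(ε + εm) + σ * (εm - ε) * t‖)
    (hK0 : 0 < K) (s : Bool) {n : ℕ} (hn : n ≠ 0) {P f b : ℂ}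
    (hcont : P * hyp s (n * ρ₀) = f * hyp s (n * ρ₀) + b)
    (hflux : εm * (f * hyp (!s) (n * ρ₀) - b) = ε * (P * hyp (!s) (n * ρ₀))) :
    ‖b‖ ≤ K * ‖f‖ * Real.exp (3 * (n * ρ₀)) := by
  have hnpos : (1 : ℝ) ≤ n := by exact_mod_cast Nat.one_le_iff_ne_zero.2 hn
  have hx : 0 < n * ρ₀ := by positivity
  set x := n * ρ₀
  have hcosh := Real.cosh_pos x
  have hsinh := Real.sinh_pos_iff.2 hx
  -- The interior amplitude `P` is eliminated from the two transmission conditions.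
  have hD : b * (ε * hyp (!s) x + εm * hyp s x) = (εm - ε) * f * (hyp s x * hyp (!s) x) := by
    linear_combination (-(hyp s x : ℂ)) * hflux - ε * hyp (!s) x * hcont
  have hprod : 2 * (hyp s x * hyp (!s) x) ≤ Real.exp x * Real.exp x := by
    have h1 : Real.cosh x ≤ Real.exp x := by rw [← Real.cosh_add_sinh]; linarith
    have h2 : 2 * Real.sinh x ≤ Real.exp x := by
      rw [← Real.cosh_add_sinh]; linarith [Real.sinh_lt_cosh x]
    have h3 : 2 * Real.sinh x * Real.cosh x ≤ Real.exp x * Real.exp x := by gcongr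
    cases s <;> simp only [hyp, Bool.not_true, Bool.not_false] <;> linarith
  have hprod0 : 0 ≤ hyp s x * hyp (!s) x := mul_nonneg (hyp_nonneg s hx.le) (hyp_nonneg _ hx.le)
  have hee : Real.exp x * Real.exp (-x) = 1 := by rw [← Real.exp_add]; simp
  -- The choice is `t = e^{-2x}`, with `σ = 1` for cosine and `σ = -1` for sine modes; `n ≥ 1` gives
  -- `t ≤ e^{-2ρ₀}`.
  have hK' := hK (Real.exp (-x) * Real.exp (-x)) (by positivity)
    (by rw [← Real.exp_add, Real.exp_le_exp]; simp only [x]; nlinarith)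
    (if s then 1 else -1) (by cases s <;> simp)
  have hDeq : (ε + εm) + ((if s then 1 else -1 : ℝ) : ℂ) * (εm - ε) *
      ((Real.exp (-x) * Real.exp (-x) : ℝ) : ℂ)
      = 2 * Real.exp (-x) * (ε * hyp (!s) x + εm * hyp s x) := by
    have hee' : (Real.exp x : ℂ) * Real.exp (-x) = 1 := by exact_mod_cast hee
    cases s
    · simp only [hyp, Bool.not_false, Bool.false_eq_true, if_false, Real.cosh_eq, Real.sinh_eq]
      push_cast at hee' ⊢
      linear_combination (-(ε + εm)) * hee'
    · simp only [hyp, Bool.not_true, if_true, Real.cosh_eq, Real.sinh_eq]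
      push_cast at hee' ⊢
      linear_combination (-(ε + εm)) * hee'
  rw [hDeq, norm_mul, norm_mul, Complex.norm_real, Real.norm_of_nonneg (Real.exp_pos _).le,
    Complex.norm_ofNat] at hK'
  set D := ε * (hyp (!s) x : ℂ) + εm * hyp s x
  have hnorm : ‖b‖ * ‖D‖ = ‖(εm : ℂ) - ε‖ * ‖f‖ * (hyp s x * hyp (!s) x) := by
    rw [← norm_mul, hD, norm_mul, norm_mul, ← Complex.ofReal_mul, Complex.norm_real,
      Real.norm_of_nonneg hprod0]
  have hE : 0 < ‖(εm : ℂ) - ε‖ := norm_pos_iff.2 (sub_ne_zero.2 hne.symm)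
  have hexp := Real.exp_pos x
  have hexp' := Real.exp_pos (-x)
  have h1 : ‖(εm : ℂ) - ε‖ * Real.exp (-x) ≤ K * (2 * ‖D‖) := by
    refine le_of_mul_le_mul_right ?_ hexp'
    linarith
  -- Of the exponent `3x`, the product of the two hyperbolic functions costs `2x` and the
  -- denominator `x`.
  have h2 : ‖(εm : ℂ) - ε‖ * (‖b‖ * Real.exp (-x)) ≤
      ‖(εm : ℂ) - ε‖ * (K * ‖f‖ * (Real.exp x * Real.exp x)) :=
    calc _ = ‖b‖ * (‖(εm : ℂ) - ε‖ * Real.exp (-x)) := by ring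
      _ ≤ ‖b‖ * (K * (2 * ‖D‖)) := by gcongr
      _ = 2 * K * (‖b‖ * ‖D‖) := by ring
      _ = K * ‖(εm : ℂ) - ε‖ * ‖f‖ * (2 * (hyp s x * hyp (!s) x)) := by rw [hnorm]; ring
      _ ≤ K * ‖(εm : ℂ) - ε‖ * ‖f‖ * (Real.exp x * Real.exp x) := by gcongr
      _ = _ := by ring
  have h3 := le_of_mul_le_mul_left h2 hE
  calc ‖b‖ = ‖b‖ * Real.exp (-x) * Real.exp x := by rw [mul_assoc, mul_comm _ (Real.exp x), hee]; ring
    _ ≤ K * ‖f‖ * (Real.exp x * Real.exp x) * Real.exp x := by gcongr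
    _ = K * ‖f‖ * Real.exp (3 * x) := by
      rw [show 3 * x = x + x + x by ring, Real.exp_add, Real.exp_add]; ring

variable {R ρ₀ εm ρz ωz : ℝ} {ε : ℂ} {a z : Plane} {u : Plane → ℂ}

theorem tendsto_dipole_cocompact (a z : Plane) :
    Tendsto (fun x => (dipole a z x : ℂ)) (cocompact Plane) (𝓝 0) := by
  have h1 : Tendsto (fun x : Plane => ‖x - z‖) (cocompact Plane) atTop := by
    refine tendsto_atTop_mono (fun x => norm_sub_norm_le x z) ?_
    exact tendsto_atTop_add_const_right _ _ (tendsto_norm_cocompact_atTop)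
  have h2 : Tendsto (fun x : Plane => (2 * Real.pi)⁻¹ * ‖a‖ / ‖x - z‖) (cocompact Plane) (𝓝 0) :=
    h1.const_div_atTop _
  refine squeeze_zero_norm' ?_ h2
  filter_upwards [h1.eventually_gt_atTop 0] with x hx
  rw [Complex.norm_real]
  exact abs_dipole_le a z (sub_ne_zero.1 (norm_pos_iff.1 hx))

/-- Both `u` and the dipole vanish at infinity, hence so does the reflected field `w`, uniformly on
large ellipses. -/
theorem IsSolution.exists_reflected (hR : 0 < R) (hρ₀ : 0 < ρ₀) (hz : ρ₀ < ρz)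
    (hz' : z = ell R ρz ωz) (hu : IsSolution R ρ₀ ε εm a z u) :
    ∃ w : Plane → ℂ, InnerProductSpace.HarmonicOnNhd w (outside R ρ₀) ∧
      (∀ x ∈ outside R ρ₀, x ≠ z → u x = (dipole a z x : ℂ) + w x) ∧
      ∀ η > 0, ∀ᶠ ρ in atTop, ∀ ω, ‖w (ell R ρ ω)‖ ≤ η := by
  obtain ⟨w, hw, huw⟩ := hu.harmonic_outside
  refine ⟨w, hw, huw, fun η hη => ?_⟩
  have hu0 : Tendsto u (cocompact Plane) (𝓝 0) :=
    hu.decay.trans_tendsto (tendsto_norm_cocompact_atTop).inv_tendsto_atTop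
  have hdiff := hu0.sub (tendsto_dipole_cocompact a z)
  rw [sub_zero, Metric.tendsto_nhds] at hdiff
  have hev := hdiff η hη
  rw [← Metric.cobounded_eq_cocompact, ← comap_norm_atTop, eventually_comap] at hev
  obtain ⟨r, hr⟩ := eventually_atTop.1 hev
  have hsinh : Tendsto (fun ρ => R * Real.sinh ρ) atTop atTop := by
    refine (tendsto_atTop_mono' _ ?_ tendsto_id).const_mul_atTop hR
    filter_upwards [eventually_ge_atTop 0] with ρ hρ using Real.self_le_sinh_iff.2 hρ
  filter_upwards [hsinh.eventually_ge_atTop r, eventually_gt_atTop ρz] with ρ h1 h2 ω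
  have hρ : 0 < ρ := hρ₀.trans (hz.trans h2)
  have hne : ell R ρ ω ≠ z := by
    rw [hz']
    exact fun he => ell_ne_of_abs_lt hR (by rwa [abs_of_pos (hρ₀.trans hz)]) he.symm
  have h3 := hr _ (h1.trans (norm_ell_ge hR hρ.le ω)) (ell R ρ ω) rfl
  rw [dist_zero_right, huw _ (ell_mem_outside (hz.trans h2) ω) hne, add_sub_cancel_left] at h3
  exact h3.le

theorem coeff_sub {f g : Plane → ℂ} {ρ : ℝ} (hf : Continuous fun ω => f (ell R ρ ω))
    (hg : Continuous fun ω => g (ell R ρ ω)) (s : Bool) (n : ℕ) :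
    coeff R (fun x => f x - g x) s n ρ = coeff R f s n ρ - coeff R g s n ρ := by
  rw [coeff, coeff, coeff, ← intervalIntegral.integral_sub]
  · simp only [sub_mul]
  · exact (hf.mul (by fun_prop)).intervalIntegrable _ _
  · exact (hg.mul (by fun_prop)).intervalIntegrable _ _

theorem continuous_slice {f : Plane → ℂ} {ρ : ℝ} (hf : ∀ ω, ContinuousAt f (ell R ρ ω)) :
    Continuous fun ω => f (ell R ρ ω) :=
  continuous_iff_continuousAt.2 fun ω => (hf ω).comp (f := fun ω => ell R ρ ω)
    ((continuous_ell R).comp (Continuous.prodMk_right ρ)).continuousAt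

theorem IsSolution.continuousAt_ell (hR : 0 < R) (hz' : z = ell R ρz ωz)
    (hu : IsSolution R ρ₀ ε εm a z u) {ρ : ℝ} (hρ : |ρ| < ρz) (ω : ℝ) :
    ContinuousAt u (ell R ρ ω) :=
  hu.continuous.continuousAt (isOpen_compl_singleton.mem_nhds (by
    rw [hz']; exact ell_ne_of_abs_lt hR hρ))

/-- The coefficients of a solution agree on the boundary ellipse with their limits from both
sides. -/
theorem IsSolution.coeff_boundary (hR : 0 < R) (hρ₀ : 0 < ρ₀) (hz : ρ₀ < ρz)
    (hz' : z = ell R ρz ωz) (hu : IsSolution R ρ₀ ε εm a z u) (s : Bool) (n : ℕ)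
    {gm gp : ℝ → ℂ} (hgm : Continuous gm) (hgp : Continuous gp)
    (hm : ∀ ρ ∈ Ioo 0 ρ₀, coeff R u s n ρ = gm ρ)
    (hp : ∀ ρ ∈ Ioo ρ₀ ρz, coeff R u s n ρ = gp ρ) :
    coeff R u s n ρ₀ = gm ρ₀ ∧ coeff R u s n ρ₀ = gp ρ₀ := by
  have hc : ContinuousAt (coeff R u s n) ρ₀ :=
    (continuousOn_coeff (I := Ioo (-ρz) ρz) (fun ρ hρ ω =>
      hu.continuousAt_ell hR hz' (abs_lt.2 hρ) ω) s n).continuousAt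
      (isOpen_Ioo.mem_nhds ⟨by linarith, hz⟩)
  constructor
  · have h1 : Tendsto (coeff R u s n) (𝓝[<] ρ₀) (𝓝 (coeff R u s n ρ₀)) :=
      hc.tendsto.mono_left nhdsWithin_le_nhds
    have h2 : Tendsto gm (𝓝[<] ρ₀) (𝓝 (gm ρ₀)) := (hgm.tendsto ρ₀).mono_left nhdsWithin_le_nhds
    refine tendsto_nhds_unique (h1.congr' ?_) h2
    filter_upwards [Ioo_mem_nhdsLT hρ₀] with ρ hρ using hm ρ hρ
  · have h1 : Tendsto (coeff R u s n) (𝓝[>] ρ₀) (𝓝 (coeff R u s n ρ₀)) :=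
      hc.tendsto.mono_left nhdsWithin_le_nhds
    have h2 : Tendsto gp (𝓝[>] ρ₀) (𝓝 (gp ρ₀)) := (hgp.tendsto ρ₀).mono_left nhdsWithin_le_nhds
    refine tendsto_nhds_unique (h1.congr' ?_) h2
    filter_upwards [Ioo_mem_nhdsGT hz] with ρ hρ using hp ρ hρ

theorem IsSolution.contDiffAt_outside (hR : 0 < R) (hρ₀ : 0 < ρ₀)
    (hu : IsSolution R ρ₀ ε εm a z u) {x : Plane} (hx : x ∈ outside R ρ₀) (hxz : x ≠ z) :
    ContDiffAt ℝ 1 u x := by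
  obtain ⟨w, hw, huw⟩ := hu.harmonic_outside
  refine ((contDiffAt_dipole a z hxz).add ((hw x hx).1.of_le (by norm_num))).congr_of_eventuallyEq
    ?_
  filter_upwards [(isOpen_outside hR hρ₀).mem_nhds hx, isOpen_ne.mem_nhds hxz] with y h1 h2
  exact huw y h1 h2

/-- The flux condition for the coefficients of a solution. -/
theorem IsSolution.coeffDeriv_boundary (hR : 0 < R) (hρ₀ : 0 < ρ₀) (hz : ρ₀ < ρz)
    (hz' : z = ell R ρz ωz) (hu : IsSolution R ρ₀ ε εm a z u) (s : Bool) (n : ℕ)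
    {gm gp gm' gp' : ℝ → ℂ} (hgm : ∀ ρ, HasDerivAt gm (gm' ρ) ρ)
    (hgp : ∀ ρ, HasDerivAt gp (gp' ρ) ρ) (hgm' : Continuous gm') (hgp' : Continuous gp')
    (hm : ∀ ρ ∈ Ioo 0 ρ₀, coeff R u s n ρ = gm ρ)
    (hp : ∀ ρ ∈ Ioo ρ₀ ρz, coeff R u s n ρ = gp ρ) :
    εm * gp' ρ₀ = ε * gm' ρ₀ := by
  choose Dm Dp hDm hDp hflux using hu.flux
  have hmem : ∀ ρ ∈ Ioo 0 ρ₀, ∀ ω, ell R ρ ω ∈ inside R ρ₀ := fun ρ hρ ω =>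
    ell_mem_inside (by rw [abs_of_pos hρ.1]; exact hρ.2) ω
  have hcm : ∀ ρ ∈ Ioo 0 ρ₀, ∀ ω, ContDiffAt ℝ 1 u (ell R ρ ω) := fun ρ hρ ω =>
    (hu.harmonic_inside _ (hmem ρ hρ ω)).1.of_le (by norm_num)
  have hcp : ∀ ρ ∈ Ioo ρ₀ ρz, ∀ ω, ContDiffAt ℝ 1 u (ell R ρ ω) := fun ρ hρ ω =>
    hu.contDiffAt_outside hR hρ₀ (ell_mem_outside hρ.1 ω) (by
      rw [hz']; exact ell_ne_of_abs_lt hR (by rw [abs_of_pos (hρ₀.trans hρ.1)]; exact hρ.2))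
  have key : ∀ {I : Set ℝ} {g g' : ℝ → ℂ}, IsOpen I →
      (∀ ρ ∈ I, ∀ ω, ContDiffAt ℝ 1 u (ell R ρ ω)) → (∀ ρ, HasDerivAt g (g' ρ) ρ) →
      (∀ ρ ∈ I, coeff R u s n ρ = g ρ) → ∀ ρ ∈ I, coeffDeriv R u s n ρ = g' ρ := by
    intro I g g' hI hc hg h ρ hρ
    refine ((hasDerivAt_coeff hI hc s n hρ).congr_of_eventuallyEq ?_).unique (hg ρ)
    filter_upwards [hI.mem_nhds hρ] with r hr using (h r hr).symm
  have hclm : ρ₀ ∈ closure (Ioo 0 ρ₀) := by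
    rw [closure_Ioo hρ₀.ne]; exact ⟨hρ₀.le, le_rfl⟩
  have hclp : ρ₀ ∈ closure (Ioo ρ₀ ρz) := by
    rw [closure_Ioo hz.ne]; exact ⟨le_rfl, hz.le⟩
  have hlim : ∀ {I : Set ℝ} {g' : ℝ → ℂ} {l : ℂ}, ρ₀ ∈ closure I → Continuous g' →
      (∀ ρ ∈ I, coeffDeriv R u s n ρ = g' ρ) →
      Tendsto (coeffDeriv R u s n) (𝓝[I] ρ₀) (𝓝 l) → l = g' ρ₀ := by
    intro I g' l hcl hc h hl
    have := mem_closure_iff_nhdsWithin_neBot.1 hcl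
    refine tendsto_nhds_unique (hl.congr' ?_) ((hc.tendsto ρ₀).mono_left nhdsWithin_le_nhds)
    filter_upwards [self_mem_nhdsWithin] with ρ hρ using h ρ hρ
  rw [← hlim hclm hgm' (key isOpen_Ioo hcm hgm hm)
      (tendsto_coeffDeriv_boundary hclm hmem hcm hDm s n),
    ← hlim hclp hgp' (key isOpen_Ioo hcp hgp hp)
      (tendsto_coeffDeriv_boundary hclp (fun ρ hρ ω => ell_mem_outside hρ.1 ω) hcp hDp s n),
    ← intervalIntegral.integral_const_mul, ← intervalIntegral.integral_const_mul]
  -- After the common scale factor is pulled out, the integrands agree by the pointwise flux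
  -- condition.
  refine intervalIntegral.integral_congr fun ω _ => ?_
  simp only [ellRho_eq_smul_unitNormal R hρ₀, map_smul, Complex.real_smul]
  linear_combination ((R * Real.sqrt (Real.sinh ρ₀ ^ 2 + Real.sin ω ^ 2) : ℝ) : ℂ) *
    (trig s (n * ω) : ℂ) * hflux ω

end Transmission

end EllipseResonance

namespace EllipseResonance

/-! ### Bounds for the modes and their summation. -/

section Estimates

variable {R ρ₀ εm ρz ωz : ℝ} {ε : ℂ} {a z : Plane} {u w : Plane → ℂ}

theorem continuous_dipole_slice (hR : 0 < R) (hz' : z = ell R ρz ωz) {ρ : ℝ} (hρ : |ρ| < ρz) :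
    Continuous fun ω => (dipole a z (ell R ρ ω) : ℂ) :=
  continuous_slice (f := fun x => (dipole a z x : ℂ)) fun ω =>
    (contDiffAt_dipole a z (by rw [hz']; exact ell_ne_of_abs_lt hR hρ)).continuousAt

theorem IsSolution.coeff_eq_add (hR : 0 < R) (hρ₀ : 0 < ρ₀) (hz' : z = ell R ρz ωz)
    (hu : IsSolution R ρ₀ ε εm a z u)
    (huw : ∀ x ∈ outside R ρ₀, x ≠ z → u x = (dipole a z x : ℂ) + w x) (s : Bool) (n : ℕ)
    {ρ : ℝ} (hρ : ρ ∈ Ioo ρ₀ ρz) :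
    coeff R u s n ρ = coeff R (fun x => (dipole a z x : ℂ)) s n ρ + coeff R w s n ρ := by
  have habs : |ρ| < ρz := by rw [abs_of_pos (hρ₀.trans hρ.1)]; exact hρ.2
  have h := coeff_sub (continuous_slice fun ω => hu.continuousAt_ell hR hz' habs ω)
    (g := fun x => (dipole a z x : ℂ)) (continuous_dipole_slice (a := a) hR hz' habs) s n
  have h2 : coeff R (fun x => u x - (dipole a z x : ℂ)) s n ρ = coeff R w s n ρ := by
    refine intervalIntegral.integral_congr fun ω _ => ?_
    have hne : ell R ρ ω ≠ z := by rw [hz']; exact ell_ne_of_abs_lt hR habs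
    simp only [huw _ (ell_mem_outside hρ.1 ω) hne, add_sub_cancel_left]
  rw [← h2, h]; ring

/-- Each mode of the field reflected by the ellipse is controlled by the incident amplitude. -/
theorem IsSolution.exists_mode_bound (hR : 0 < R) (hρ₀ : 0 < ρ₀) (hz : ρ₀ < ρz)
    (hz' : z = ell R ρz ωz) (hu : IsSolution R ρ₀ ε εm a z u) {K : ℝ} (hK0 : 0 < K)
    (hne : ε ≠ εm)
    (hK : ∀ t : ℝ, 0 < t → t ≤ Real.exp (-(2 * ρ₀)) → ∀ σ : ℝ, (σ = 1 ∨ σ = -1) →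
        ‖(εm : ℂ) - ε‖ * t ≤ K * ‖(ε + εm) + σ * (εm - ε) * t‖)
    (hw : InnerProductSpace.HarmonicOnNhd w (outside R ρ₀))
    (huw : ∀ x ∈ outside R ρ₀, x ≠ z → u x = (dipole a z x : ℂ) + w x)
    (hdecay : ∀ η > 0, ∀ᶠ ρ in atTop, ∀ ω, ‖w (ell R ρ ω)‖ ≤ η)
    (s : Bool) {n : ℕ} (hn : n ≠ 0) {f : ℂ}
    (hf : ∀ ρ, |ρ| < ρz →
      coeff R (fun x => (dipole a z x : ℂ)) s n ρ = f * hyp s (n * ρ)) :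
    ∃ b : ℂ, ‖b‖ ≤ K * ‖f‖ * Real.exp (3 * (n * ρ₀)) ∧
      (∀ ρ, ρ₀ < ρ → coeff R w s n ρ = b * Real.exp (-(n * (ρ - ρ₀)))) ∧
      ∀ ρ, 0 ≤ ρ → ρ ≤ ρ₀ →
        ‖coeff R u s n ρ - coeff R (fun x => (dipole a z x : ℂ)) s n ρ‖ ≤ ‖b‖ := by
  obtain ⟨P, hP⟩ := exists_coeff_eq_hyp hu.harmonic_inside s hn
  obtain ⟨b, hb⟩ := exists_coeff_eq_exp_neg hw hdecay s hn
  have hn' : (n : ℂ) ≠ 0 := by exact_mod_cast hn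
  have hm : ∀ ρ ∈ Ioo 0 ρ₀, coeff R u s n ρ = P * hyp s (n * ρ) := fun ρ hρ =>
    hP ρ (by rw [abs_of_pos hρ.1]; exact hρ.2)
  have hp : ∀ ρ ∈ Ioo ρ₀ ρz, coeff R u s n ρ =
      f * hyp s (n * ρ) + b * Real.exp (-(n * (ρ - ρ₀))) := fun ρ hρ => by
    rw [hu.coeff_eq_add hR hρ₀ hz' huw s n hρ, hb ρ hρ.1,
      hf ρ (by rw [abs_of_pos (hρ₀.trans hρ.1)]; exact hρ.2)]
  have hch : ∀ s : Bool, Continuous fun ρ : ℝ => (hyp s (n * ρ) : ℂ) := fun s =>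
    Complex.continuous_ofReal.comp ((continuous_hyp s).comp (by fun_prop))
  have hdh : ∀ ρ : ℝ, HasDerivAt (fun r : ℝ => (hyp s (n * r) : ℂ))
      (n * hyp (!s) (n * ρ)) ρ := fun ρ => by
    refine (((hasDerivAt_hyp s (n * ρ)).comp ρ
      ((hasDerivAt_id ρ).const_mul (n : ℝ))).ofReal_comp).congr_deriv ?_
    push_cast; ring
  have hde : ∀ ρ : ℝ, HasDerivAt (fun r : ℝ => ((Real.exp (-(n * (r - ρ₀))) : ℝ) : ℂ))
      (-(n * Real.exp (-(n * (ρ - ρ₀))))) ρ := fun ρ => by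
    refine (((((hasDerivAt_id ρ).sub_const ρ₀).const_mul (n : ℝ)).neg.exp).ofReal_comp).congr_deriv
      ?_
    push_cast; simp; ring
  have hce : Continuous fun ρ : ℝ => ((Real.exp (-(n * (ρ - ρ₀))) : ℝ) : ℂ) :=
    Complex.continuous_ofReal.comp (by fun_prop)
  obtain ⟨e1, e2⟩ := hu.coeff_boundary hR hρ₀ hz hz' s n (continuous_const.mul (hch s))
    ((continuous_const.mul (hch s)).add (continuous_const.mul hce)) hm hp
  have e3 := hu.coeffDeriv_boundary hR hρ₀ hz hz' s n
    (fun ρ => (hdh ρ).const_mul P) (fun ρ => ((hdh ρ).const_mul f).add ((hde ρ).const_mul b))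
    (continuous_const.mul (continuous_const.mul (hch _)))
    ((continuous_const.mul (continuous_const.mul (hch _))).add
      (continuous_const.mul (continuous_const.mul hce).neg)) hm hp
  simp only [Pi.add_apply, Pi.mul_apply, sub_self, mul_zero, neg_zero, Real.exp_zero, Complex.ofReal_one, mul_one] at e2 e3
  have hcont : P * hyp s (n * ρ₀) = f * hyp s (n * ρ₀) + b := e1.symm.trans e2
  have hflux : εm * (f * hyp (!s) (n * ρ₀) - b) = ε * (P * hyp (!s) (n * ρ₀)) :=
    mul_left_cancel₀ hn' (by linear_combination e3)
  refine ⟨b, norm_reflected_le hρ₀ hne hK hK0 s hn hcont hflux, hb, fun ρ h0 h1 => ?_⟩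
  have hu' : coeff R u s n ρ = P * hyp s (n * ρ) := by
    rcases h1.lt_or_eq with h | rfl
    · exact hP ρ (by rwa [abs_of_nonneg h0])
    · exact e1
  -- Inside, the mode of `u - F_z` is `(P - f)` times a hyperbolic function increasing in `ρ`, and
  -- its value at `ρ₀` is `b`.
  rw [hu', hf ρ (by rw [abs_of_nonneg h0]; exact h1.trans_lt hz), ← sub_mul,
    show b = (P - f) * hyp s (n * ρ₀) by linear_combination -hcont, norm_mul, norm_mul,
    Complex.norm_real, Complex.norm_real, Real.norm_of_nonneg (hyp_nonneg s (by positivity)),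
    Real.norm_of_nonneg (hyp_nonneg s (by positivity))]
  gcongr
  exact hyp_mono s (by positivity) (by gcongr)

/-- The mean of `u` is constant in `ρ` inside and equals the dipole's constant `c₀` in the annulus
up to `z`, since `w` has mean zero there; continuity at `ρ₀` matches the two. -/
theorem IsSolution.coeff_zero_sub (hR : 0 < R) (hρ₀ : 0 < ρ₀) (hz : ρ₀ < ρz)
    (hz' : z = ell R ρz ωz) (hu : IsSolution R ρ₀ ε εm a z u)
    (hw : InnerProductSpace.HarmonicOnNhd w (outside R ρ₀))
    (huw : ∀ x ∈ outside R ρ₀, x ≠ z → u x = (dipole a z x : ℂ) + w x)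
    (hdecay : ∀ η > 0, ∀ᶠ ρ in atTop, ∀ ω, ‖w (ell R ρ ω)‖ ≤ η) {c₀ : ℂ}
    (hc₀ : ∀ ρ, |ρ| < ρz → coeff R (fun x => (dipole a z x : ℂ)) true 0 ρ = c₀) {ρ : ℝ}
    (h0 : 0 ≤ ρ) (h1 : ρ ≤ ρ₀) :
    coeff R u true 0 ρ - coeff R (fun x => (dipole a z x : ℂ)) true 0 ρ = 0 := by
  obtain ⟨A, hA⟩ := exists_coeff_zero_eq hu.harmonic_inside
  obtain ⟨e1, e2⟩ := hu.coeff_boundary hR hρ₀ hz hz' true 0 (continuous_const (y := A))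
    (continuous_const (y := c₀)) (fun ρ hρ => hA ρ (by rw [abs_of_pos hρ.1]; exact hρ.2))
    (fun ρ hρ => by
      rw [hu.coeff_eq_add hR hρ₀ hz' huw true 0 hρ, coeff_zero_eq_zero hw hdecay hρ.1, add_zero,
        hc₀ ρ (by rw [abs_of_pos (hρ₀.trans hρ.1)]; exact hρ.2)])
  rw [hc₀ ρ (by rw [abs_of_nonneg h0]; exact h1.trans_lt hz), sub_eq_zero]
  rcases h1.lt_or_eq with h | rfl
  · rw [hA ρ (by rwa [abs_of_nonneg h0]), ← e1, e2]
  · exact e2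

theorem summable_exp_neg_succ_mul {τ : ℝ} (hτ : 0 < τ) :
    Summable fun n : ℕ => Real.exp (-((n : ℝ) + 1) * τ) := by
  have h := (summable_geometric_of_lt_one (Real.exp_pos (-τ)).le
    (Real.exp_lt_one_iff.2 (by linarith))).mul_left (Real.exp (-τ))
  refine h.congr fun n => ?_
  rw [← Real.exp_nat_mul, ← Real.exp_add]
  congr 1; ring

/-- The perturbation of the dipole field by the ellipse, with an explicit dependence on the
permittivity through the constant `K` only. -/
theorem IsSolution.norm_sub_dipole_le (hR : 0 < R) (hρ₀ : 0 < ρ₀) (hz : ρ₀ < ρz)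
    (hz' : z = ell R ρz ωz) (hu : IsSolution R ρ₀ ε εm a z u) {K : ℝ} (hK0 : 0 < K)
    (hne : ε ≠ εm)
    (hK : ∀ t : ℝ, 0 < t → t ≤ Real.exp (-(2 * ρ₀)) → ∀ σ : ℝ, (σ = 1 ∨ σ = -1) →
        ‖(εm : ℂ) - ε‖ * t ≤ K * ‖(ε + εm) + σ * (εm - ε) * t‖)
    {C : ℝ} {c₀ : ℂ}
    (hc₀ : ∀ ρ, |ρ| < ρz → coeff R (fun x => (dipole a z x : ℂ)) true 0 ρ = c₀)
    (hF : ∀ (s : Bool) (n : ℕ), n ≠ 0 → ∃ f : ℂ, ‖f‖ ≤ C * Real.exp (-(n * ρz)) ∧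
      ∀ ρ, |ρ| < ρz → coeff R (fun x => (dipole a z x : ℂ)) s n ρ = f * hyp s (n * ρ))
    {ρ ω : ℝ} (hρ : 0 ≤ ρ) (hx : ell R ρ ω ≠ z) (hτ : 0 < ρ + ρz - 4 * ρ₀) :
    ‖u (ell R ρ ω) - (dipole a z (ell R ρ ω) : ℂ)‖ ≤
      2 / Real.pi * (K * C) *
        ∑' n : ℕ, Real.exp (-((n : ℝ) + 1) * (ρ + ρz - 4 * ρ₀)) := by
  obtain ⟨w, hw, huw, hdecay⟩ := hu.exists_reflected hR hρ₀ hz hz'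
  have hmode : ∀ (s : Bool) (n : ℕ), ∃ b : ℂ,
      ‖b‖ ≤ K * C * Real.exp (-((n : ℝ) + 1) * (ρz - 3 * ρ₀)) ∧
      (∀ ρ, ρ₀ < ρ → coeff R w s (n + 1) ρ = b * Real.exp (-((n + 1 : ℕ) * (ρ - ρ₀)))) ∧
      ∀ ρ, 0 ≤ ρ → ρ ≤ ρ₀ → ‖coeff R u s (n + 1) ρ -
        coeff R (fun x => (dipole a z x : ℂ)) s (n + 1) ρ‖ ≤ ‖b‖ := by
    intro s n
    obtain ⟨f, hf, hf'⟩ := hF s (n + 1) n.succ_ne_zero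
    obtain ⟨b, hb, hb1, hb2⟩ := hu.exists_mode_bound hR hρ₀ hz hz' hK0 hne hK hw huw hdecay s
      n.succ_ne_zero hf'
    refine ⟨b, hb.trans ?_, hb1, hb2⟩
    calc K * ‖f‖ * Real.exp (3 * ((n + 1 : ℕ) * ρ₀))
        ≤ K * (C * Real.exp (-((n + 1 : ℕ) * ρz))) * Real.exp (3 * ((n + 1 : ℕ) * ρ₀)) := by
          gcongr
      _ = K * C * (Real.exp (-((n + 1 : ℕ) * ρz)) * Real.exp (3 * ((n + 1 : ℕ) * ρ₀))) := by ring
      _ = _ := by rw [← Real.exp_add]; congr 2; push_cast; ring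
  -- The sign follows from the bound on a norm, as `C ≥ 0` is not assumed.
  have hKC : 0 ≤ K * C := by
    obtain ⟨b, hb, -⟩ := hmode true 0
    exact nonneg_of_mul_nonneg_left ((norm_nonneg b).trans hb) (Real.exp_pos _)
  have hsum := (summable_exp_neg_succ_mul hτ).mul_left (K * C)
  rw [mul_assoc, ← tsum_mul_left]
  rcases le_or_gt ρ ρ₀ with h1 | h1
  · have habs : |ρ| < ρz := by rw [abs_of_nonneg hρ]; exact h1.trans_lt hz
    have hcu := continuous_slice fun ω => hu.continuousAt_ell hR hz' habs ω
    have hcd := continuous_dipole_slice (a := a) hR hz' habs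
    have hsub := fun (s : Bool) (n : ℕ) =>
      coeff_sub hcu (g := fun x => (dipole a z x : ℂ)) hcd s n
    have hbound : ∀ (s : Bool) (n : ℕ),
        ‖coeff R (fun x => u x - (dipole a z x : ℂ)) s (n + 1) ρ‖ ≤
          K * C * Real.exp (-((n : ℝ) + 1) * (ρ + ρz - 4 * ρ₀)) := by
      intro s n
      obtain ⟨b, hb, -, hb2⟩ := hmode s n
      rw [hsub]
      -- Inside, `ρ ≤ ρ₀` gives `ρ + ρz - 4ρ₀ ≤ ρz - 3ρ₀`, so the stated rate is the weaker one.
      refine (hb2 ρ hρ h1).trans (hb.trans ?_)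
      refine mul_le_mul_of_nonneg_left (Real.exp_le_exp.2 ?_) hKC
      rw [neg_mul, neg_mul, neg_le_neg_iff]
      exact mul_le_mul_of_nonneg_left (by linarith) (by positivity)
    refine norm_le_tsum_of_trig_coeff_le
      (f := fun ω => u (ell R ρ ω) - (dipole a z (ell R ρ ω) : ℂ)) (hcu.sub hcd)
      (fun ω => by simp only [ell_add_two_pi]) ?_ hsum (hbound true) (hbound false) ω
    have h0 := hu.coeff_zero_sub hR hρ₀ hz hz' hw huw hdecay hc₀ hρ h1
    rw [← hsub, coeff] at h0
    simpa [trig] using h0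
  -- Outside, the series is that of `w`, which is regular at `z`, so ellipses through or beyond `z`
  -- need no separate treatment.
  · have hcw : Continuous fun ω => w (ell R ρ ω) :=
      continuous_slice fun ω => (hw _ (ell_mem_outside h1 ω)).1.continuousAt
    have hbound : ∀ (s : Bool) (n : ℕ), ‖coeff R w s (n + 1) ρ‖ ≤
          K * C * Real.exp (-((n : ℝ) + 1) * (ρ + ρz - 4 * ρ₀)) := by
      intro s n
      obtain ⟨b, hb, hb1, -⟩ := hmode s n
      rw [hb1 ρ h1, norm_mul, Complex.norm_real, Real.norm_of_nonneg (Real.exp_pos _).le]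
      calc _ ≤ K * C * Real.exp (-((n : ℝ) + 1) * (ρz - 3 * ρ₀)) *
            Real.exp (-((n + 1 : ℕ) * (ρ - ρ₀))) := by gcongr
        _ = _ := by rw [mul_assoc, ← Real.exp_add]; congr 2; push_cast; ring
    rw [huw _ (ell_mem_outside h1 ω) hx, add_sub_cancel_left]
    refine norm_le_tsum_of_trig_coeff_le (f := fun ω => w (ell R ρ ω)) hcw
      (fun ω => by simp only [ell_add_two_pi]) ?_ hsum (hbound true) (hbound false) ω
    have h0 := coeff_zero_eq_zero hw hdecay h1
    rw [coeff] at h0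
    simpa [trig] using h0

end Estimates

end EllipseResonance

/-! ### The two uniform estimates. -/

open EllipseResonance in
theorem mainTheorem7 (R ρ₀ εm : ℝ) (hR : 0 < R) (hρ₀ : 0 < ρ₀) (hεm : 0 < εm)
    -- the source position `z`, outside the closed ellipse, and the dipole moment `a`
    (ρz ωz : ℝ) (hz : ρ₀ < ρz) (a z : Plane) (hz' : z = ell R ρz ωz)
    -- the permittivity in the ellipse: `ε_c + iδ` with `ε_c + ε_m = 0`, or the one that
    -- corresponds to the normalization `λ = iδ`
    (εin : ℝ → ℂ)
    (hεin : (∀ δ : ℝ, 0 < δ → εin δ = -(εm : ℂ) + Complex.I * (δ : ℂ)) ∨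
      (∀ δ : ℝ, 0 < δ →
        (εin δ + (εm : ℂ)) / (2 * (εin δ - (εm : ℂ))) = Complex.I * (δ : ℂ))) :
    (∃ C : ℝ, 0 < C ∧ ∀ δ : ℝ, 0 < δ → ∀ u : Plane → ℂ,
      IsSolution R ρ₀ (εin δ) εm a z u →
      ∀ (x : Plane) (ρx ωx : ℝ), 0 ≤ ρx → x = ell R ρx ωx → x ≠ z → 0 < ρx + ρz - 4 * ρ₀ →
        ‖u x - (dipole a z x : ℂ)‖ ≤
          C * ∑' n : ℕ, Real.exp (-((n : ℝ) + 1) * (ρx + ρz - 4 * ρ₀))) ∧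
    (∀ ρbar : ℝ, 0 < ρbar → 4 * ρ₀ - ρz < ρbar →
      ∃ C : ℝ, 0 < C ∧ ∀ δ : ℝ, 0 < δ → ∀ u : Plane → ℂ,
        IsSolution R ρ₀ (εin δ) εm a z u →
        ∀ (x : Plane) (ρx ωx : ℝ), ρbar ≤ ρx → x = ell R ρx ωx → x ≠ z →
          ‖u x - (dipole a z x : ℂ)‖ < C) := by
  have part1 : ∃ C : ℝ, 0 < C ∧ ∀ δ : ℝ, 0 < δ → ∀ u : Plane → ℂ,
      IsSolution R ρ₀ (εin δ) εm a z u →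
      ∀ (x : Plane) (ρx ωx : ℝ), 0 ≤ ρx → x = ell R ρx ωx → x ≠ z → 0 < ρx + ρz - 4 * ρ₀ →
        ‖u x - (dipole a z x : ℂ)‖ ≤
          C * ∑' n : ℕ, Real.exp (-((n : ℝ) + 1) * (ρx + ρz - 4 * ρ₀)) := by
    obtain ⟨K, hK0, hK⟩ := norm_sub_mul_le_of_permittivity hρ₀ hεm hεin
    obtain ⟨C, c₀, hC, hc₀, hF⟩ := exists_integral_dipole hR a ρz ωz (hρ₀.trans hz)
    rw [← hz'] at hc₀ hF
    have hpi := Real.pi_pos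
    -- The summand `1` keeps the constant positive when `C = 0`, as for `a = 0`.
    refine ⟨2 / Real.pi * (K * C) + 1, by positivity, fun δ hδ u hu x ρx ωx hρx hx hxz hτ => ?_⟩
    subst hx
    refine (hu.norm_sub_dipole_le hR hρ₀ hz hz' hK0 (hK δ hδ).1 (hK δ hδ).2 (c₀ := c₀)
      (fun ρ hρ => ?_) hF hρx hxz hτ).trans ?_
    · rw [← hc₀ ρ hρ]
      exact intervalIntegral.integral_congr fun ω _ => by simp [trig]
    · gcongr
      linarith
  refine ⟨part1, fun ρbar hρbar hbar => ?_⟩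
  obtain ⟨C, hC, h⟩ := part1
  have hs := summable_exp_neg_succ_mul (τ := ρbar + ρz - 4 * ρ₀) (by linarith)
  refine ⟨C * ∑' n : ℕ, Real.exp (-((n : ℝ) + 1) * (ρbar + ρz - 4 * ρ₀)) + 1,
    by positivity, fun δ hδ u hu x ρx ωx hρx hx hxz => ?_⟩
  have hτ : 0 < ρx + ρz - 4 * ρ₀ := by linarith
  refine (h δ hδ u hu x ρx ωx (hρbar.le.trans hρx) hx hxz hτ).trans_lt (lt_add_of_le_of_pos ?_
    one_pos)
  refine mul_le_mul_of_nonneg_left ?_ hC.le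
  refine (summable_exp_neg_succ_mul hτ).tsum_le_tsum (fun n => ?_) hs
  rw [Real.exp_le_exp, neg_mul, neg_mul, neg_le_neg_iff]
  gcongr
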